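/- Let $\mathfrak{o}$ be a complete discrete valuation ring with maximal ideal $\mathfrak{p}$, uniformizer $\pi$, and finite residue field of odd characteristic. Let $\mathfrak{O}$ be an unramified quadratic extension of $\mathfrak{o}$ with maximal ideal $\mathfrak{P}=\pi\mathfrak{O}$, and let $x\mapsto x^\circ$ be the non-trivial automorphism of $\mathfrak{O}$ over $\mathfrak{o}$. For $\ell\ge 0$ put $\mathfrak{o}_\ell=\mathfrak{o}/\mathfrak{p}^\ell$ and $\mathfrak{O}_\ell=\mathfrak{O}/\mathfrak{P}^\ell$; thus $\mathfrak{o}_\ell\subseteq\mathfrak{O}_\ell$, and $x\mapsto x^\circ$ also denotes the induced automorphism of $\mathfrak{O}_\ell$. Put $W=\begin{pmatrix}0&1\\1&0\end{pmatrix}$ and, for a matrix $A=(a_{ij})\in M_2(\mathfrak{O}_\ell)$, put $A^\star=W(a_{ji}^\circ)W^{-1}$. Let $$\mathrm{GU}_2(\mathfrak{o}_\ell)=\{A\in \mathrm{GL}_2(\mathfrak{O}_\ell) : A^\star A=\mathrm{I}_2\}.$$ An element $g$ of a group $G$ is called real if $hgh^{-1}=g^{-1}$ for some $h\in G$, and strongly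 real if $hgh^{-1}=g^{-1}$ for some $h\in G$ with $h^2=1$. For $\ell\ge 1$, consider the following families of elements of $\mathrm{GU}_2(\mathfrak{o}_\ell)$: (a) $\begin{pmatrix}x&0\\0&x\end{pmatrix}$, where $x\in\{\pm1\}$; (b) $\begin{pmatrix}x&0\\0&x^{-1}\end{pmatrix}$, where $x\in\mathfrak{o}_\ell^\times$ and $x^2\ne 1$; (c) $\begin{pmatrix}0&1\\1&0\end{pmatrix}$, and $\begin{pmatrix}x&y\\y&x\end{pmatrix}$, where $x,y\in\mathfrak{O}_\ell$, $y\neq 0$, $xx^\circ+yy^\circ=1$, $xy^\circ+x^\circ y=0$ and $x^2-y^2=1$; (d) $\begin{pmatrix}x&\pi^{i+1}\beta y\\ \pi^i y&x\end{pmatrix}$, where $0\le i\le \ell-1$, $\beta\in\mathfrak{o}_{\ell-i-1}$, $x\in\mathfrak{o}_\ell^\times$, $y\in\mathfrak{O}_\ell^\times$, $x^2+\pi^{2i+1}\beta yy^\circ=1=x^2-\pi^{2i+1}\beta y^2$ and $\pi^i(xy^\circ+x^\circ y)=0$ (the elements $\pi^{i+1}\beta$ and $\pi^{2i+1}\beta$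 of $\mathfrak{o}_\ell$ do not depend on the lift of $\beta$ to $\mathfrak{o}_\ell$). Then, for every $\ell\ge 1$, a real element of $\mathrm{GU}_2(\mathfrak{o}_\ell)$ is strongly real if and only if it is conjugate in $\mathrm{GU}_2(\mathfrak{o}_\ell)$ to an element of one of the families (a), (b), (c). The elements of family (d) are real but not strongly real. -/

import Mathlib

open IsLocalRing

namespace GUTwo

/-! ### Real and strongly real elements of a group -/

/-- `g` is real if it is conjugate to its inverse. -/
def IsReal {G : Type*} [Group G] (g : G) : Prop :=
  ∃ h : G, h * g * h⁻¹ = g⁻¹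

/-- `g` is strongly real if it is conjugated to its inverse by an involution, where an involution
is an element `h` with `h ^ 2 = 1`. -/
def IsStronglyReal {G : Type*} [Group G] (g : G) : Prop :=
  ∃ h : G, h ^ 2 = 1 ∧ h * g * h⁻¹ = g⁻¹

/-! ### The unitary group in two variables -/

section Unitary

variable {R : Type*} [CommRing R]

/-- The permutation matrix of the longest Weyl element. -/
def W (R : Type*) [CommRing R] : Matrix (Fin 2) (Fin 2) R := !![0, 1; 1, 0]

lemma W_mul_W : W R * W R = 1 := by
  ext i j
  fin_cases i <;> fin_cases j <;> simp [W, Matrix.mul_apply]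

lemma W_inv : (W R)⁻¹ = W R := Matrix.inv_eq_right_inv W_mul_W

/-- The operation `(a i j)⋆ = W (c (a j i)) W⁻¹` attached to an endomorphism `c` of `R`. -/
noncomputable def starOp (c : R →+* R) (A : Matrix (Fin 2) (Fin 2) R) :
    Matrix (Fin 2) (Fin 2) R :=
  W R * (A.map c).transpose * (W R)⁻¹

lemma starOp_of (c : R →+* R) (p q r s : R) :
    starOp c !![p, q; r, s] = !![c s, c q; c r, c p] := by
  have h : (!![p, q; r, s].map c).transpose = !![c p, c r; c q, c s] := by
    ext i j
    fin_cases i <;> fin_cases j <;> rfl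
  rw [starOp, W_inv, h, W, Matrix.mul_fin_two, Matrix.mul_fin_two]
  simp

lemma starOp_mul (c : R →+* R) (A B : Matrix (Fin 2) (Fin 2) R) :
    starOp c (A * B) = starOp c B * starOp c A := by
  have h : W R * (W R * (A.map c).transpose * W R) = (A.map c).transpose * W R := by
    rw [← mul_assoc, ← mul_assoc, W_mul_W, one_mul]
  rw [starOp, starOp, starOp, W_inv, Matrix.map_mul, Matrix.transpose_mul]
  rw [mul_assoc (W R * (B.map c).transpose) (W R), h]
  simp only [mul_assoc]

lemma starOp_one (c : R →+* R) : starOp c (1 : Matrix (Fin 2) (Fin 2) R) = 1 := by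
  rw [Matrix.one_fin_two, starOp_of]
  simp

/-- The group of all `A` in `GL₂(R)` with `A⋆ A = 1`. -/
noncomputable def unitaryGroup (c : R →+* R) : Subgroup (Matrix.GeneralLinearGroup (Fin 2) R) where
  carrier := {A | starOp c (A : Matrix (Fin 2) (Fin 2) R) * (A : Matrix (Fin 2) (Fin 2) R) = 1}
  one_mem' := by simp [starOp_one]
  mul_mem' := by
    intro A B hA hB
    change _ = _ at hA hB ⊢
    rw [Matrix.GeneralLinearGroup.coe_mul, starOp_mul, mul_assoc,
      ← mul_assoc (starOp c (A : Matrix (Fin 2) (Fin 2) R)), hA, one_mul, hB]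
  inv_mem' := by
    intro A hA
    change _ = _ at hA ⊢
    have h1 : (A : Matrix (Fin 2) (Fin 2) R) * ((A⁻¹ : Matrix.GeneralLinearGroup (Fin 2) R) :
        Matrix (Fin 2) (Fin 2) R) = 1 := A.mul_inv
    have h2 : starOp c (A : Matrix (Fin 2) (Fin 2) R) =
        ((A⁻¹ : Matrix.GeneralLinearGroup (Fin 2) R) : Matrix (Fin 2) (Fin 2) R) := by
      rw [← mul_one (starOp c _), ← h1, ← mul_assoc, hA, one_mul]
    rw [← h2, ← starOp_mul, h2, h1, starOp_one]

end Unitary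

/-! ### The truncated rings -/

/-- The truncation `R / 𝔪 ^ ℓ` of a local ring `R` with maximal ideal `𝔪`. -/
abbrev Trunc (R : Type*) [CommRing R] [IsLocalRing R] (ℓ : ℕ) : Type _ :=
  R ⧸ (maximalIdeal R) ^ ℓ

section Truncation

variable {𝔬 𝔒 : Type*} [CommRing 𝔬] [IsLocalRing 𝔬] [CommRing 𝔒] [IsLocalRing 𝔒]

lemma pow_le_comap_pow (f : 𝔬 →+* 𝔒) [IsLocalHom f] (ℓ : ℕ) :
    (maximalIdeal 𝔬) ^ ℓ ≤ ((maximalIdeal 𝔒) ^ ℓ).comap f := by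
  rw [← Ideal.map_le_iff_le_comap, Ideal.map_pow]
  exact Ideal.pow_right_mono (map_maximalIdeal_le f) ℓ

/-- The homomorphism `𝔬 / 𝔭 ^ ℓ → 𝔒 / 𝔓 ^ ℓ` induced by a local homomorphism `𝔬 → 𝔒`. -/
def truncMap (f : 𝔬 →+* 𝔒) [IsLocalHom f] (ℓ : ℕ) : Trunc 𝔬 ℓ →+* Trunc 𝔒 ℓ :=
  Ideal.quotientMap ((maximalIdeal 𝔒) ^ ℓ) f (pow_le_comap_pow f ℓ)

variable [Algebra 𝔬 𝔒]

/-- The canonical map `𝔬_ℓ → 𝔒_ℓ`. -/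
def incl (𝔬 𝔒 : Type*) [CommRing 𝔬] [IsLocalRing 𝔬] [CommRing 𝔒] [IsLocalRing 𝔒] [Algebra 𝔬 𝔒]
    [IsLocalHom (algebraMap 𝔬 𝔒)] (ℓ : ℕ) : Trunc 𝔬 ℓ →+* Trunc 𝔒 ℓ :=
  truncMap (algebraMap 𝔬 𝔒) ℓ

/-- The endomorphism `x ↦ x°` of `𝔒_ℓ` induced by an automorphism `σ` of `𝔒` over `𝔬`. -/
def conj (σ : 𝔒 ≃ₐ[𝔬] 𝔒) (ℓ : ℕ) : Trunc 𝔒 ℓ →+* Trunc 𝔒 ℓ :=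
  truncMap (σ.toRingEquiv : 𝔒 →+* 𝔒) ℓ

/-- The finite unitary group `GU₂(𝔬_ℓ)`: the matrices `A` in `GL₂(𝔒_ℓ)` with `A⋆ A = 1`. -/
noncomputable abbrev GU (σ : 𝔒 ≃ₐ[𝔬] 𝔒) (ℓ : ℕ) :
    Subgroup (Matrix.GeneralLinearGroup (Fin 2) (Trunc 𝔒 ℓ)) :=
  unitaryGroup (conj σ ℓ)

/-! ### The four families of matrices -/

/-- Family (a): the scalar matrices `x` with `x = 1` or `x = -1`. -/
def familyA (𝔒 : Type*) [CommRing 𝔒] [IsLocalRing 𝔒] (ℓ : ℕ) :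
    Set (Matrix (Fin 2) (Fin 2) (Trunc 𝔒 ℓ)) :=
  {M | ∃ x : Trunc 𝔒 ℓ, (x = 1 ∨ x = -1) ∧ M = !![x, 0; 0, x]}

/-- Family (b): the matrices `diag(x, x⁻¹)` with `x` a unit of `𝔬_ℓ` and `x ^ 2 ≠ 1`. -/
def familyB (𝔬 𝔒 : Type*) [CommRing 𝔬] [IsLocalRing 𝔬] [CommRing 𝔒] [IsLocalRing 𝔒] [Algebra 𝔬 𝔒]
    [IsLocalHom (algebraMap 𝔬 𝔒)] (ℓ : ℕ) : Set (Matrix (Fin 2) (Fin 2) (Trunc 𝔒 ℓ)) :=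
  {M | ∃ x : (Trunc 𝔬 ℓ)ˣ, x ^ 2 ≠ 1 ∧
    M = !![incl 𝔬 𝔒 ℓ (x : Trunc 𝔬 ℓ), 0; 0, incl 𝔬 𝔒 ℓ ((x⁻¹ : (Trunc 𝔬 ℓ)ˣ) : Trunc 𝔬 ℓ)]}

/-- Family (c): the matrix `!![0, 1; 1, 0]`, and the matrices `!![x, y; y, x]` over `𝔒_ℓ` with
`y ≠ 0`, `x x° + y y° = 1`, `x y° + x° y = 0` and `x ^ 2 - y ^ 2 = 1`. -/
def familyC (σ : 𝔒 ≃ₐ[𝔬] 𝔒) (ℓ : ℕ) : Set (Matrix (Fin 2) (Fin 2) (Trunc 𝔒 ℓ)) :=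
  {M | M = !![0, 1; 1, 0] ∨ ∃ x y : Trunc 𝔒 ℓ, y ≠ 0 ∧
    x * conj σ ℓ x + y * conj σ ℓ y = 1 ∧
    x * conj σ ℓ y + conj σ ℓ x * y = 0 ∧
    x ^ 2 - y ^ 2 = 1 ∧
    M = !![x, y; y, x]}

/-- Family (d), with respect to a uniformizer `π` of `𝔬`: the matrices
`!![x, π ^ (i + 1) β y; π ^ i y, x]` with `0 ≤ i ≤ ℓ - 1`, `β ∈ 𝔬_(ℓ - i - 1)`, `x` a unit of `𝔬_ℓ`
and `y` a unit of `𝔒_ℓ` such that `x ^ 2 + π ^ (2 i + 1) β y y° = 1 = x ^ 2 - π ^ (2 i + 1) β y ^ 2`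
and `π ^ i (x y° + x° y) = 0`. The elements `π ^ (i + 1) β` and `π ^ (2 i + 1) β` of `𝔬_ℓ` depend
only on the class of `β` in `𝔬_(ℓ - i - 1)`; here `β` runs over representatives in `𝔬_ℓ`. -/
def familyD (π : 𝔬) (σ : 𝔒 ≃ₐ[𝔬] 𝔒) [IsLocalHom (algebraMap 𝔬 𝔒)] (ℓ : ℕ) :
    Set (Matrix (Fin 2) (Fin 2) (Trunc 𝔒 ℓ)) :=
  {M | ∃ i : ℕ, i < ℓ ∧ ∃ (b : Trunc 𝔬 ℓ) (a : (Trunc 𝔬 ℓ)ˣ) (u : (Trunc 𝔒 ℓ)ˣ),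
    let x : Trunc 𝔒 ℓ := incl 𝔬 𝔒 ℓ (a : Trunc 𝔬 ℓ)
    let β : Trunc 𝔒 ℓ := incl 𝔬 𝔒 ℓ b
    let ϖ : Trunc 𝔒 ℓ := Ideal.Quotient.mk _ (algebraMap 𝔬 𝔒 π)
    let y : Trunc 𝔒 ℓ := (u : Trunc 𝔒 ℓ)
    x ^ 2 + ϖ ^ (2 * i + 1) * β * y * conj σ ℓ y = 1 ∧
    x ^ 2 - ϖ ^ (2 * i + 1) * β * y ^ 2 = 1 ∧
    ϖ ^ i * (x * conj σ ℓ y + conj σ ℓ x * y) = 0 ∧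
    M = !![x, ϖ ^ (i + 1) * β * y; ϖ ^ i * y, x]}

end Truncation

end GUTwo

/-! Over R = 𝔒_ℓ with c = °, every involution of the unitary group is ±1 or conjugate to W
(`involution_classification`). So a strongly real g either satisfies g² = 1 or is, up to conjugacy,
inverted by W. By `eq_of_weyl_conj_eq_inv` an element inverted by W is bW with b² = 1, or t + N with
N = (m, b; -b, -m), where t and m are fixed by c and c b = -b. The pair (m, b) is the single element
z = m + b of R, and -det N = m² - b² is its norm z c(z). If z ≠ 0, write z = ϖⁿw with w a unit: then
N = ϖⁿN' and -det N' is the norm of w, a unit fixed by c. Such a unit is s² with c s = s or c s =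
-s. In the first case g is conjugate to diag(t + ϖⁿs, t - ϖⁿs), family (b); in the second to the
circulant of t and ϖⁿs, family (c). Conversely each normal form has an explicit inverting
involution.

An element of family (d) is x + ϖⁱM, where M is nonzero but nilpotent modulo the maximal ideal. Were
it strongly real, a conjugate of M would have the shape of N modulo that ideal, with norm z c(z) = 0
there; this forces z = 0, hence M = 0, which is absurd (`not_isStronglyReal_of_val_eq`).

The arithmetic needed (units of 𝔬 are norms, and are squares of fixed or antifixed elements of 𝔒)
follows from Hensel's lemma and the finite residue field, and passes to the truncations in
`isUnramifiedInvolution`. -/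

namespace GUTwo

/-! ### Matrix calculus in the unitary group -/

section General

variable {R : Type*} [CommRing R] {c : R →+* R}

lemma starOp_mul_self_eq_one_iff (p q r s : R) :
    starOp c !![p, q; r, s] * !![p, q; r, s] = 1 ↔
      c s * p + c q * r = 1 ∧ c s * q + c q * s = 0 ∧ c r * p + c p * r = 0 ∧
        c r * q + c p * s = 1 := by
  rw [starOp_of, Matrix.mul_fin_two, Matrix.one_fin_two, ← Matrix.ext_iff]
  simp [Fin.forall_fin_two, and_assoc]

lemma unitaryGroup_ext {a b : unitaryGroup c} (h : a.1.1 = b.1.1) : a = b :=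
  Subtype.ext (Units.ext h)

lemma unitaryGroup_starOp_mul (a : unitaryGroup c) : starOp c a.1.1 * a.1.1 = 1 := a.2

lemma unitaryGroup_val_inv (a : unitaryGroup c) : (a⁻¹).1.1 = starOp c a.1.1 := by
  have h : a.1.1 * (a⁻¹).1.1 = 1 := congrArg (fun x : unitaryGroup c => x.1.1) (mul_inv_cancel a)
  rw [← one_mul (a⁻¹).1.1, ← unitaryGroup_starOp_mul a, mul_assoc, h, mul_one]

lemma exists_unitaryGroup_val_eq {p q r s : R} (h₁ : c s * p + c q * r = 1)
    (h₂ : c s * q + c q * s = 0) (h₃ : c r * p + c p * r = 0) (h₄ : c r * q + c p * s = 1) :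
    ∃ k : unitaryGroup c, k.1.1 = !![p, q; r, s] := by
  have h := (starOp_mul_self_eq_one_iff (c := c) p q r s).2 ⟨h₁, h₂, h₃, h₄⟩
  exact ⟨⟨⟨_, _, mul_eq_one_comm.1 h, h⟩, h⟩, rfl⟩

lemma isConj_of_val_mul_eq {a b k : unitaryGroup c} (h : a.1.1 * k.1.1 = k.1.1 * b.1.1) :
    IsConj a b := by
  have h' : a * k = k * b := unitaryGroup_ext h
  rw [isConj_comm, isConj_iff]
  exact ⟨k, by rw [← h', mul_inv_cancel_right]⟩

/-- The matrix `W` as an element of the unitary group. -/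
def weyl (c : R →+* R) : unitaryGroup c :=
  ⟨⟨W R, W R, W_mul_W, W_mul_W⟩, by
    change starOp c (W R) * W R = 1
    rw [W, starOp_mul_self_eq_one_iff]
    simp⟩

lemma weyl_val : (weyl c).1.1 = !![0, 1; 1, 0] := rfl

lemma IsStronglyReal.of_isConj {G : Type*} [Group G] {a b : G} (hab : IsConj a b)
    (hb : IsStronglyReal b) : IsStronglyReal a := by
  obtain ⟨k, rfl⟩ := isConj_iff.1 hab
  obtain ⟨h, h₁, h₂⟩ := hb
  refine ⟨k⁻¹ * h * k, ?_, ?_⟩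
  · calc (k⁻¹ * h * k) ^ 2 = k⁻¹ * h ^ 2 * k := by simp only [pow_two]; group
      _ = 1 := by rw [h₁, mul_one, inv_mul_cancel]
  · calc _ = k⁻¹ * (h * (k * a * k⁻¹) * h⁻¹) * k := by group
      _ = k⁻¹ * (k * a * k⁻¹)⁻¹ * k := by rw [h₂]
      _ = _ := by group

end General

/-- An involution `c` of a local ring that behaves like the conjugation of an unramified quadratic
extension with finite residue field of odd characteristic, truncated at a power of a uniformizer
`ϖ`. -/
structure IsUnramifiedInvolution {R : Type*} [CommRing R] [IsLocalRing R] (c : R →+* R) (ϖ : R) :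
    Prop where
  invol : ∀ x, c (c x) = x
  two : IsUnit (2 : R)
  norm : ∀ u, IsUnit u → c u = u → ∃ z, z * c z = u
  sqrt : ∀ u, IsUnit u → c u = u → ∃ s, s ^ 2 = u ∧ (c s = s ∨ c s = -s)
  fix : c ϖ = ϖ
  mem : ϖ ∈ maximalIdeal R
  chain : ∀ z, z ≠ 0 → ∃ (k : ℕ) (w : R), IsUnit w ∧ z = ϖ ^ k * w

/-! ### Involutions of the unitary group -/

namespace IsUnramifiedInvolution

variable {R : Type*} [CommRing R] [IsLocalRing R] {c : R →+* R} {ϖ : R}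

lemma map_mem (H : IsUnramifiedInvolution c ϖ) {x : R} (hx : x ∈ maximalIdeal R) :
    c x ∈ maximalIdeal R := by
  rw [mem_maximalIdeal, mem_nonunits_iff] at *
  intro h
  have := h.map c
  rw [H.invol] at this
  exact hx this

lemma mem_of_two_mul_mem (H : IsUnramifiedInvolution c ϖ) {x : R} (hx : 2 * x ∈ maximalIdeal R) :
    x ∈ maximalIdeal R :=
  ((maximalIdeal R).unit_mul_mem_iff_mem H.two).1 hx

lemma two_mul_cancel (H : IsUnramifiedInvolution c ϖ) {x y : R} (h : 2 * x = 2 * y) : x = y :=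
  H.two.mul_left_cancel h

lemma exists_half (H : IsUnramifiedInvolution c ϖ) (x : R) : ∃ y, 2 * y = x := by
  obtain ⟨t, ht⟩ := H.two.exists_right_inv
  exact ⟨t * x, by linear_combination x * ht⟩

lemma map_eq_of_two_mul (H : IsUnramifiedInvolution c ϖ) {x y : R} (h : c (2 * x) = 2 * y) :
    c x = y := by
  rw [map_mul, map_ofNat] at h
  exact H.two_mul_cancel h

lemma isUnit_of_mul_notMem {x y : R} (h : x * y ∉ maximalIdeal R) :
    IsUnit x ∧ IsUnit y := by
  rw [notMem_maximalIdeal] at h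
  exact ⟨isUnit_of_mul_isUnit_left h, isUnit_of_mul_isUnit_right h⟩

lemma eq_one_or_eq_neg_one (H : IsUnramifiedInvolution c ϖ) {x : R} (hx : x ^ 2 = 1) :
    x = 1 ∨ x = -1 := by
  by_cases h : x - 1 ∈ maximalIdeal R
  · by_cases h' : x + 1 ∈ maximalIdeal R
    · have h2 : (2 : R) ∈ maximalIdeal R := by
        convert Ideal.sub_mem _ h' h using 1
        ring
      exact absurd H.two h2
    · rw [notMem_maximalIdeal] at h'
      left
      apply h'.mul_left_cancel
      linear_combination hx
  · rw [notMem_maximalIdeal] at h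
    right
    apply h.mul_left_cancel
    linear_combination hx

lemma one_notMem : (1 : R) ∉ maximalIdeal R :=
  (Ideal.ne_top_iff_one _).1 (IsLocalRing.maximalIdeal.isMaximal R).ne_top

/-- An involution in the unitary group is either scalar or conjugate to `W`. -/
lemma involution_classification (H : IsUnramifiedInvolution c ϖ) {h : unitaryGroup c}
    (hh : h ^ 2 = 1) :
    (h.1.1 = 1 ∨ h.1.1 = -1) ∨ ∃ k : unitaryGroup c, h * k = k * weyl c := by
  have h1 : h.1.1 * h.1.1 = 1 := by
    rw [pow_two] at hh
    exact congrArg (fun x : unitaryGroup c => x.1.1) hh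
  have h2 : starOp c h.1.1 = h.1.1 := by
    rw [← unitaryGroup_val_inv, inv_eq_of_mul_eq_one_left (by rwa [← pow_two])]
  obtain ⟨p, q, r, s, hM⟩ : ∃ p q r s, h.1.1 = !![p, q; r, s] :=
    ⟨_, _, _, _, Matrix.eta_fin_two _⟩
  rw [hM, Matrix.mul_fin_two, Matrix.one_fin_two, ← Matrix.ext_iff] at h1
  rw [hM, starOp_of, ← Matrix.ext_iff] at h2
  simp only [Fin.forall_fin_two, Matrix.of_apply, Matrix.cons_val', Matrix.cons_val_zero,
    Matrix.cons_val_one, Matrix.cons_val_fin_one] at h1 h2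
  obtain ⟨⟨e1, e2⟩, e3, e4⟩ := h1
  obtain ⟨⟨f1, f2⟩, f3, f4⟩ := h2
  -- The off-diagonal entries and p² - s² are multiples of the trace p + s and vanish, so a unit
  -- trace makes h scalar; a non-unit trace turns out to be 0.
  by_cases ht : p + s ∈ maximalIdeal R
  · right
    have hps : s = -p := by
      suffices p + s = 0 by linear_combination this
      by_cases hd : p - s ∈ maximalIdeal R
      · have hp : p ∈ maximalIdeal R := H.mem_of_two_mul_mem (by
          convert Ideal.add_mem _ ht hd using 1
          ring)
        have hqr : q * r ∉ maximalIdeal R := fun hm => one_notMem (by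
          rw [← e1]
          exact Ideal.add_mem _ (Ideal.mul_mem_right _ _ hp) hm)
        refine (isUnit_of_mul_notMem hqr).1.mul_left_cancel ?_
        linear_combination e2
      · refine (notMem_maximalIdeal.1 hd).mul_left_cancel ?_
        linear_combination e1 - e4
    subst hps
    have hc : c p = -p := f4
    have hN : (1 - p) * (1 + p) = q * r := by linear_combination -e1
    -- qr = (1 - p)(1 + p), and c exchanges the two factors; if one were a non-unit, so would be the
    -- other, and then also their sum 2.
    have hu : q * r ∉ maximalIdeal R := by
      intro hm
      have h3 : 1 - p ∈ maximalIdeal R ∧ 1 + p ∈ maximalIdeal R := by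
        rw [← hN] at hm
        rcases ((IsLocalRing.maximalIdeal.isMaximal R).isPrime.mem_or_mem hm) with h | h
        · refine ⟨h, ?_⟩
          have := H.map_mem h
          rwa [map_sub, map_one, hc, sub_neg_eq_add] at this
        · refine ⟨?_, h⟩
          have := H.map_mem h
          rwa [map_add, map_one, hc, ← sub_eq_add_neg] at this
      have h4 : (2 : R) ∈ maximalIdeal R := by
        convert Ideal.add_mem _ h3.1 h3.2 using 1
        ring
      exact h4 H.two
    obtain ⟨r', hr'⟩ := (isUnit_of_mul_notMem hu).2.exists_right_inv
    have hcr' : c r' = r' := by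
      apply (isUnit_of_mul_notMem hu).2.mul_left_cancel
      rw [hr', ← map_one c, ← hr', map_mul, f3]
    obtain ⟨l, hl⟩ := H.norm r' (IsUnit.of_mul_eq_one r (by rw [mul_comm, hr'])) hcr'
    -- The columns of k are l e₁ and l h(e₁), which h exchanges; the norm r⁻¹ of l makes k unitary.
    obtain ⟨k, hk⟩ := exists_unitaryGroup_val_eq (c := c) (p := l) (q := l * p) (r := 0)
      (s := l * r) (by simp [f3]; linear_combination r * hl + hr')
      (by simp [f3, hc]; ring) (by simp) (by simp; linear_combination r * hl + hr')
    refine ⟨k, unitaryGroup_ext ?_⟩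
    change h.1.1 * k.1.1 = k.1.1 * (weyl c).1.1
    rw [hM, hk, weyl_val, Matrix.mul_fin_two, Matrix.mul_fin_two]
    ext i j
    fin_cases i <;> fin_cases j <;> simp
    · ring
    · linear_combination l * e1
    · ring
    · ring
  · left
    rw [notMem_maximalIdeal] at ht
    have hq : q = 0 := ht.mul_left_cancel (by linear_combination e2)
    have hr : r = 0 := ht.mul_left_cancel (by linear_combination e3)
    subst hq hr
    have hp : p = s := sub_eq_zero.1 <| ht.mul_left_cancel (by linear_combination e1 - e4)
    subst hp
    rw [hM]
    rcases H.eq_one_or_eq_neg_one (x := p) (by linear_combination e1) with rfl | rfl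
    · left; rw [Matrix.one_fin_two]
    · right; rw [Matrix.one_fin_two]; simp

end IsUnramifiedInvolution
end GUTwo

/-! ### Elements inverted by W, and their normal forms -/

namespace GUTwo
namespace IsUnramifiedInvolution

variable {R : Type*} [CommRing R] [IsLocalRing R] {c : R →+* R} {ϖ : R}

/-- The elements inverted by `W` are `W`, `-W` and certain matrices of determinant one. -/
lemma eq_of_weyl_conj_eq_inv (H : IsUnramifiedInvolution c ϖ) {g : unitaryGroup c}
    (hg : weyl c * g * (weyl c)⁻¹ = g⁻¹) :
    (∃ b : R, b ^ 2 = 1 ∧ c b = b ∧ g.1.1 = !![0, b; b, 0]) ∨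
    ∃ a b d : R, c a = a ∧ c d = d ∧ c b = -b ∧ a * d + b ^ 2 = 1 ∧ g.1.1 = !![a, b; -b, d] := by
  have h1 : weyl c * g = g⁻¹ * weyl c := by rw [← hg]; group
  have h2 : (weyl c).1.1 * g.1.1 = (g⁻¹).1.1 * (weyl c).1.1 :=
    congrArg (fun x : unitaryGroup c => x.1.1) h1
  have h3 := unitaryGroup_starOp_mul g
  rw [unitaryGroup_val_inv] at h2
  obtain ⟨a, b, b', d, hM⟩ : ∃ p q r s, g.1.1 = !![p, q; r, s] :=
    ⟨_, _, _, _, Matrix.eta_fin_two _⟩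
  rw [hM, weyl_val, starOp_of, Matrix.mul_fin_two, Matrix.mul_fin_two, ← Matrix.ext_iff] at h2
  rw [hM, starOp_mul_self_eq_one_iff] at h3
  simp only [Fin.forall_fin_two, Matrix.of_apply, Matrix.cons_val', Matrix.cons_val_zero,
    Matrix.cons_val_one, Matrix.cons_val_fin_one, zero_mul, one_mul, mul_zero, mul_one, zero_add,
    add_zero] at h2
  obtain ⟨⟨rfl, hd⟩, ha, hb⟩ := h2
  obtain ⟨e1, e2, e3, e4⟩ := h3
  rw [H.invol] at e3 e4
  rw [← hd] at e1 e2
  rw [← ha] at e3 e4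
  -- The unitary relations give (b + c b)a = (b + c b)d = (b + c b)(b - c b) = 0. Since b² + ad = 1,
  -- the elements a and b are not both in the maximal ideal.
  by_cases h0 : b + c b ∈ maximalIdeal R
  · right
    suffices b + c b = 0 by
      have hcb : c b = -b := by linear_combination this
      exact ⟨a, b, d, ha.symm, hd.symm, hcb, by linear_combination e4, by rw [hM, hcb]⟩
    by_cases ha' : a ∈ maximalIdeal R
    · by_cases hb' : b - c b ∈ maximalIdeal R
      · exfalso
        have hbm : b ∈ maximalIdeal R := H.mem_of_two_mul_mem (by
          convert Ideal.add_mem _ h0 hb' using 1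
          ring)
        refine one_notMem (R := R) ?_
        rw [← e4]
        exact Ideal.add_mem _ (Ideal.mul_mem_right _ _ hbm) (Ideal.mul_mem_right _ _ ha')
      · refine (notMem_maximalIdeal.1 hb').mul_left_cancel ?_
        linear_combination e4 - e1
    · refine (notMem_maximalIdeal.1 ha').mul_left_cancel ?_
      linear_combination e3
  · left
    rw [notMem_maximalIdeal] at h0
    have ha0 : a = 0 := h0.mul_left_cancel (by linear_combination e3)
    have hd0 : d = 0 := h0.mul_left_cancel (by linear_combination e2)
    subst ha0 hd0
    have hb : c b = b := (sub_eq_zero.1 <| h0.mul_left_cancel (by linear_combination e4 - e1)).symm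
    exact ⟨b, by linear_combination e4, hb, by rw [hM, hb]⟩

/-- The elements of the unitary group that are diagonal with scalar entries, diagonal and fixed by
conjugation, or symmetric circulant. -/
def IsNormalForm (c : R →+* R) (M : Matrix (Fin 2) (Fin 2) R) : Prop :=
  (∃ x : R, (x = 1 ∨ x = -1) ∧ M = !![x, 0; 0, x]) ∨
  (∃ x y : R, c x = x ∧ c y = y ∧ x * y = 1 ∧ x ^ 2 ≠ 1 ∧ M = !![x, 0; 0, y]) ∨
  (M = !![0, 1; 1, 0] ∨ ∃ x y : R, y ≠ 0 ∧ x * c x + y * c y = 1 ∧ x * c y + c x * y = 0 ∧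
    x ^ 2 - y ^ 2 = 1 ∧ M = !![x, y; y, x])

lemma exists_isConj_weyl (H : IsUnramifiedInvolution c ϖ) {g : unitaryGroup c} {b : R}
    (hb : b ^ 2 = 1) (hcb : c b = b) (hg : g.1.1 = !![0, b; b, 0]) : IsConj g (weyl c) := by
  obtain ⟨l, hl⟩ := H.norm b (IsUnit.of_mul_eq_one b (by rw [← pow_two, hb])) hcb
  obtain ⟨k, hk⟩ := exists_unitaryGroup_val_eq (c := c) (p := l) (q := 0) (r := 0)
    (s := b * l) (by simp [hcb]; linear_combination b * hl + hb)
    (by simp) (by simp) (by simp; linear_combination b * hl + hb)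
  refine isConj_of_val_mul_eq (k := k) ?_
  rw [hg, hk, weyl_val]
  ext i j
  fin_cases i <;> fin_cases j <;> simp
  linear_combination l * hb

/-- The matrix (m, b; -b, -m) has eigenvalues ±s. The columns of k are eigenvectors for s and -s;
the factor e = (2s(m + s))⁻¹ in the second makes k unitary. -/
lemma exists_isConj_diagonal (H : IsUnramifiedInvolution c ϖ) {g : unitaryGroup c}
    {m b s t v : R} (hm : c m = m) (hb : c b = -b) (hs : c s = s) (hsu : IsUnit s)
    (ht : c t = t) (hv : c v = v) (hmb : s ^ 2 = m ^ 2 - b ^ 2) (htv : t ^ 2 - v ^ 2 * s ^ 2 = 1)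
    (hg : g.1.1 = !![t + v * m, v * b; -(v * b), t - v * m]) (hms : IsUnit (m + s)) :
    ∃ B : unitaryGroup c, IsConj g B ∧ B.1.1 = !![t + v * s, 0; 0, t - v * s] := by
  obtain ⟨B, hB⟩ := exists_unitaryGroup_val_eq (c := c) (p := t + v * s) (q := 0) (r := 0)
    (s := t - v * s) (by simp [ht, hv, hs]; linear_combination htv)
    (by simp) (by simp) (by simp [ht, hv, hs]; linear_combination htv)
  obtain ⟨n, hn⟩ := hms.exists_right_inv
  obtain ⟨e, he⟩ := ((H.two.mul hsu).mul hms).exists_right_inv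
  have hcn : c n = n := by
    apply hms.mul_left_cancel
    rw [hn, ← map_one c, ← hn, map_mul, map_add, hm, hs]
  have hce : c e = e := by
    apply ((H.two.mul hsu).mul hms).mul_left_cancel
    rw [he, ← map_one c, ← he, map_mul, map_mul, map_mul, map_add, hm, hs, map_ofNat]
  obtain ⟨k, hk⟩ := exists_unitaryGroup_val_eq (c := c) (p := 1) (q := -(e * (m + s) * b))
    (r := -(n * b)) (s := e * (m + s) ^ 2)
    (by simp [hce, hm, hs, hb]; linear_combination he - e * hmb - e * b ^ 2 * hn)
    (by simp [hce, hm, hs, hb]; ring)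
    (by simp [hcn, hb])
    (by simp [hcn, hb]; linear_combination he - e * hmb - e * b ^ 2 * hn)
  refine ⟨B, isConj_of_val_mul_eq (k := k) ?_, hB⟩
  rw [hg, hk, hB]
  ext i j
  fin_cases i <;> fin_cases j <;> simp
  · linear_combination -v * n * hmb - v * (m - s) * hn
  · ring
  · linear_combination v * b * hn
  · linear_combination v * e * (m + s) * hmb

/-- Here s is not fixed by c. Instead of diagonalizing, use the vectors (m, -b) and (s, 0): (m, -b;
b, -m) with the sign of b reversed, that is the traceless matrix of g, sends each to s times the
other. -/
lemma exists_isConj_circulant (H : IsUnramifiedInvolution c ϖ) {g : unitaryGroup c}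
    {m b s t v : R} (hm : c m = m) (hb : c b = -b) (hs : c s = -s) (hsu : IsUnit s)
    (ht : c t = t) (hv : c v = v) (hmb : s ^ 2 = m ^ 2 - b ^ 2) (htv : t ^ 2 - v ^ 2 * s ^ 2 = 1)
    (hg : g.1.1 = !![t + v * m, v * b; -(v * b), t - v * m]) :
    ∃ B : unitaryGroup c, IsConj g B ∧ B.1.1 = !![t, v * s; v * s, t] := by
  obtain ⟨B, hB⟩ := exists_unitaryGroup_val_eq (c := c) (p := t) (q := v * s) (r := v * s)
    (s := t) (by simp [ht, hv, hs]; linear_combination htv)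
    (by simp [ht, hv, hs]; ring) (by simp [ht, hv, hs]; ring)
    (by simp [ht, hv, hs]; linear_combination htv)
  -- Otherwise b² = (m + s)(m - s) is a non-unit. As c exchanges the factors, both are non-units,
  -- and so is their difference 2s.
  have hbu : IsUnit b := by
    rw [← notMem_maximalIdeal]
    intro hbm
    have hprod : (m + s) * (m - s) ∈ maximalIdeal R := by
      rw [show (m + s) * (m - s) = b * b by linear_combination -hmb]
      exact Ideal.mul_mem_right _ _ hbm
    have h3 : m + s ∈ maximalIdeal R ∧ m - s ∈ maximalIdeal R := by
      rcases ((IsLocalRing.maximalIdeal.isMaximal R).isPrime.mem_or_mem hprod) with h | h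
      · refine ⟨h, ?_⟩
        have := H.map_mem h
        rwa [map_add, hm, hs, ← sub_eq_add_neg] at this
      · refine ⟨?_, h⟩
        have := H.map_mem h
        rwa [map_sub, hm, hs, sub_neg_eq_add] at this
    exact H.mem_of_two_mul_mem (by
      convert Ideal.sub_mem _ h3.1 h3.2 using 1
      ring) hsu
  obtain ⟨e, he⟩ := (hsu.mul hbu).exists_right_inv
  have hce : c e = e := by
    apply (hsu.mul hbu).mul_left_cancel
    rw [he, ← map_one c, ← he, map_mul, map_mul, hs, hb]
    ring
  obtain ⟨l, hl⟩ := H.norm e (IsUnit.of_mul_eq_one (s * b) (by rw [mul_comm, he])) hce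
  obtain ⟨k, hk⟩ := exists_unitaryGroup_val_eq (c := c) (p := l * m) (q := l * s)
    (r := -(l * b)) (s := 0)
    (by simp [hs]; linear_combination he + s * b * hl)
    (by simp) (by simp [hb, hm]; ring)
    (by simp [hb]; linear_combination he + s * b * hl)
  refine ⟨B, isConj_of_val_mul_eq (k := k) ?_, hB⟩
  rw [hg, hk, hB]
  ext i j
  fin_cases i <;> fin_cases j <;> simp
  · linear_combination -l * v * hmb
  · ring
  · ring
  · ring

lemma exists_isConj_isNormalForm_of_weyl (H : IsUnramifiedInvolution c ϖ) {g : unitaryGroup c}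
    (hg : weyl c * g * (weyl c)⁻¹ = g⁻¹) :
    ∃ B : unitaryGroup c, IsConj g B ∧ IsNormalForm c B.1.1 := by
  obtain ⟨b, hb, hcb, hgb⟩ | ⟨a, b, d, ha, hd, hb, hab, hM⟩ := H.eq_of_weyl_conj_eq_inv hg
  · exact ⟨_, H.exists_isConj_weyl hb hcb hgb, .inr (.inr (.inl rfl))⟩
  obtain ⟨m, hm2⟩ := H.exists_half (a - d)
  obtain ⟨t, ht2⟩ := H.exists_half (a + d)
  have hm : c m = m := H.map_eq_of_two_mul (by rw [hm2, map_sub, ha, hd])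
  have ht : c t = t := H.map_eq_of_two_mul (by rw [ht2, map_add, ha, hd])
  have ea : a = t + m := H.two_mul_cancel (by linear_combination -hm2 - ht2)
  have ed : d = t - m := H.two_mul_cancel (by linear_combination hm2 - ht2)
  subst ea ed
  by_cases hz : m + b = 0
  · have hm0 : m = 0 := H.two_mul_cancel (by
      have := congrArg c hz
      rw [map_add, hm, hb, map_zero] at this
      linear_combination hz + this)
    subst hm0
    have hb0 : b = 0 := by linear_combination hz
    subst hb0
    refine ⟨g, IsConj.refl _, .inl ⟨t, H.eq_one_or_eq_neg_one (by linear_combination hab), ?_⟩⟩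
    rw [hM]; simp
  · obtain ⟨n, w, hw, hzw⟩ := H.chain _ hz
    obtain ⟨m', hm2'⟩ := H.exists_half (w + c w)
    obtain ⟨b', hb2'⟩ := H.exists_half (w - c w)
    have hm' : c m' = m' := H.map_eq_of_two_mul (by rw [hm2', map_add, H.invol, add_comm])
    have hb' : c b' = -b' := H.map_eq_of_two_mul (by
      rw [hb2', map_sub, H.invol]; linear_combination hb2')
    generalize hv : ϖ ^ n = v at hzw
    have hcv : c v = v := by rw [← hv, map_pow, H.fix]
    have hv0 : v ≠ 0 := by rintro rfl; exact hz (by rw [hzw, zero_mul])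
    have hczw := congrArg c hzw
    rw [map_add, hm, hb, map_mul, hcv] at hczw
    have em : m = v * m' := H.two_mul_cancel (by linear_combination hzw + hczw - v * hm2')
    have eb : b = v * b' := H.two_mul_cancel (by linear_combination hzw - hczw - v * hb2')
    subst em eb
    obtain ⟨s, hs, hcs⟩ := H.sqrt (w * c w) (hw.mul (hw.map c)) (by
      rw [map_mul, H.invol, mul_comm])
    have hsu : IsUnit s := by
      refine isUnit_of_mul_isUnit_left (y := s) ?_
      rw [← pow_two, hs]
      exact hw.mul (hw.map c)
    have hmb : s ^ 2 = m' ^ 2 - b' ^ 2 := by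
      refine H.two_mul_cancel (H.two_mul_cancel ?_)
      linear_combination 4 * hs - (2 * m' + (w + c w)) * hm2' + (2 * b' + (w - c w)) * hb2'
    have htv : t ^ 2 - v ^ 2 * s ^ 2 = 1 := by
      linear_combination hab - v ^ 2 * hmb
    have hvs : v * s ≠ 0 := fun h => hv0 (hsu.mul_right_cancel (by rw [h, zero_mul]))
    rcases hcs with hcs | hcs
    · have key : ∀ s', c s' = s' → IsUnit s' → s' ^ 2 = m' ^ 2 - b' ^ 2 → v * s' ≠ 0 →
          t ^ 2 - v ^ 2 * s' ^ 2 = 1 → IsUnit (m' + s') →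
          ∃ B : unitaryGroup c, IsConj g B ∧ IsNormalForm c B.1.1 := by
        intro s hcs hsu hmb hvs htv hms
        obtain ⟨B, hgB, hB⟩ := H.exists_isConj_diagonal hm' hb' hcs hsu ht hcv hmb htv hM hms
        refine ⟨B, hgB, .inr (.inl ⟨_, _, ?_, ?_, ?_, ?_, hB⟩)⟩
        · simp [ht, hcv, hcs]
        · simp [ht, hcv, hcs]
        · linear_combination htv
        · intro h
          have hu : IsUnit (t + v * s) :=
            IsUnit.of_mul_eq_one (t + v * s) (by rw [← pow_two, h])
          refine hvs (H.two_mul_cancel (hu.mul_left_cancel ?_))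
          linear_combination h - htv
      -- The difference of m' + s and m' - s is the unit 2s, so one of the two is a unit; the sign
      -- of s is free.
      by_cases hms : IsUnit (m' + s)
      · exact key s hcs hsu hmb hvs htv hms
      · refine key (-s) (by rw [map_neg, hcs]) hsu.neg (by rw [neg_sq, hmb]) (by simpa using hvs)
          (by rw [neg_sq, htv]) ?_
        rw [← notMem_maximalIdeal]
        intro h
        refine H.mem_of_two_mul_mem ?_ hsu
        convert Ideal.sub_mem _ ((mem_maximalIdeal _).2 hms) h using 1
        ring
    · obtain ⟨B, hgB, hB⟩ := H.exists_isConj_circulant hm' hb' hcs hsu ht hcv hmb htv hM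
      refine ⟨B, hgB, .inr (.inr (.inr ⟨_, _, hvs, ?_, ?_, ?_, hB⟩))⟩
      · simp [ht, hcv, hcs]; linear_combination htv
      · simp [ht, hcv, hcs]
      · linear_combination htv

lemma exists_conj_weyl_of_isStronglyReal (H : IsUnramifiedInvolution c ϖ) {g : unitaryGroup c}
    (hg : IsStronglyReal g) :
    g ^ 2 = 1 ∨ ∃ k : unitaryGroup c,
      weyl c * (k⁻¹ * g * k) * (weyl c)⁻¹ = (k⁻¹ * g * k)⁻¹ := by
  obtain ⟨h, hh, hg⟩ := hg
  rcases H.involution_classification hh with h1 | ⟨k, hk⟩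
  · left
    have hc : h * g = g * h := by
      apply unitaryGroup_ext
      change h.1.1 * g.1.1 = g.1.1 * h.1.1
      rcases h1 with h1 | h1 <;> simp [h1]
    rw [hc, mul_inv_cancel_right] at hg
    rw [pow_two, ← eq_inv_iff_mul_eq_one]
    exact hg
  · refine .inr ⟨k, ?_⟩
    have hw : weyl c = k⁻¹ * h * k := by rw [mul_assoc, hk, inv_mul_cancel_left]
    calc _ = k⁻¹ * (h * g * h⁻¹) * k := by rw [hw]; group
      _ = k⁻¹ * g⁻¹ * k := by rw [hg]
      _ = _ := by group

lemma exists_isConj_isNormalForm (H : IsUnramifiedInvolution c ϖ) {g : unitaryGroup c}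
    (hg : IsStronglyReal g) : ∃ B : unitaryGroup c, IsConj g B ∧ IsNormalForm c B.1.1 := by
  rcases H.exists_conj_weyl_of_isStronglyReal hg with h | ⟨k, hk⟩
  · rcases H.involution_classification h with h1 | ⟨k, hk⟩
    · refine ⟨g, IsConj.refl _, .inl ?_⟩
      rcases h1 with h1 | h1
      · exact ⟨1, .inl rfl, by rw [h1, Matrix.one_fin_two]⟩
      · exact ⟨-1, .inr rfl, by rw [h1, Matrix.one_fin_two]; simp⟩
    · exact ⟨weyl c, isConj_of_val_mul_eq (congrArg (fun x : unitaryGroup c => x.1.1) hk),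
        .inr (.inr (.inl rfl))⟩
  · obtain ⟨B, hB, hB'⟩ := H.exists_isConj_isNormalForm_of_weyl hk
    exact ⟨B, IsConj.trans (isConj_iff.2 ⟨k⁻¹, by group⟩) hB, hB'⟩

lemma exists_norm_eq_neg_one (H : IsUnramifiedInvolution c ϖ) : ∃ z : R, z * c z = -1 :=
  H.norm _ isUnit_one.neg (by simp)

lemma isStronglyReal_of_isNormalForm (H : IsUnramifiedInvolution c ϖ) {B : unitaryGroup c}
    (hB : IsNormalForm c B.1.1) : IsStronglyReal B := by
  have hW : weyl c ^ 2 = 1 := by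
    apply unitaryGroup_ext
    rw [pow_two]
    exact W_mul_W
  rcases hB with ⟨x, hx, hB⟩ | ⟨x, y, hx, hy, hxy, -, hB⟩ | hB | ⟨x, y, hy, h1, h2, h3, hB⟩
  · refine ⟨1, one_pow _, ?_⟩
    rw [one_mul, inv_one, mul_one, eq_inv_iff_mul_eq_one]
    apply unitaryGroup_ext
    change B.1.1 * B.1.1 = 1
    rw [hB, Matrix.mul_fin_two, Matrix.one_fin_two]
    rcases hx with rfl | rfl <;> simp
  · refine ⟨weyl c, hW, ?_⟩
    rw [mul_inv_eq_iff_eq_mul]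
    apply unitaryGroup_ext
    change (weyl c).1.1 * B.1.1 = (B⁻¹).1.1 * (weyl c).1.1
    rw [unitaryGroup_val_inv, hB, starOp_of, weyl_val]
    simp [hx, hy]
  · have : B = weyl c := unitaryGroup_ext hB
    subst this
    refine ⟨weyl c, hW, ?_⟩
    rw [mul_inv_cancel_right, eq_inv_iff_mul_eq_one, ← pow_two, hW]
  · obtain ⟨l, hl⟩ := H.exists_norm_eq_neg_one
    obtain ⟨p, hp⟩ := H.exists_half (l - c l)
    obtain ⟨q, hq⟩ := H.exists_half (l + c l)
    have hcp : c p = -p := H.map_eq_of_two_mul (by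
      rw [hp, map_sub, H.invol]; linear_combination hp)
    have hcq : c q = q := H.map_eq_of_two_mul (by rw [hq, map_add, H.invol, add_comm])
    have hpq : p ^ 2 - q ^ 2 = 1 := by
      refine H.two_mul_cancel (H.two_mul_cancel ?_)
      linear_combination -4 * hl + (2 * p + (l - c l)) * hp - (2 * q + (l + c l)) * hq
    -- With q + p of norm -1, the matrix k has trace 0 and determinant -1, so k² = 1. It
    -- anticommutes with W, so it takes x + yW to x - yW, the inverse.
    obtain ⟨k, hk⟩ := exists_unitaryGroup_val_eq (c := c) (p := p) (q := q) (r := -q) (s := -p)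
      (by simp [hcp, hcq]; linear_combination hpq) (by simp [hcp, hcq]; ring)
      (by simp [hcp, hcq]; ring) (by simp [hcp, hcq]; linear_combination hpq)
    refine ⟨k, unitaryGroup_ext ?_, ?_⟩
    · rw [pow_two]
      change k.1.1 * k.1.1 = 1
      rw [hk, Matrix.mul_fin_two, Matrix.one_fin_two]
      ext i j
      fin_cases i <;> fin_cases j <;> simp
      · linear_combination hpq
      · ring
      · ring
      · linear_combination hpq
    · have hinv : (B⁻¹).1.1 = !![x, -y; -y, x] := by
        have h : B.1.1 * !![x, -y; -y, x] = 1 := by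
          rw [hB, Matrix.mul_fin_two, Matrix.one_fin_two]
          ext i j
          fin_cases i <;> fin_cases j <;> simp
          · linear_combination h3
          · ring
          · ring
          · linear_combination h3
        rw [unitaryGroup_val_inv, ← mul_one (starOp c _), ← h, ← mul_assoc,
          unitaryGroup_starOp_mul, one_mul]
      rw [mul_inv_eq_iff_eq_mul]
      apply unitaryGroup_ext
      change k.1.1 * B.1.1 = (B⁻¹).1.1 * k.1.1
      rw [hinv, hB, hk]
      ext i j
      fin_cases i <;> fin_cases j <;> simp <;> ring

/-- An element is strongly real if and only if it is conjugate to a normal form. -/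
theorem isStronglyReal_iff (H : IsUnramifiedInvolution c ϖ) (g : unitaryGroup c) :
    IsStronglyReal g ↔ ∃ B : unitaryGroup c, IsConj g B ∧ IsNormalForm c B.1.1 :=
  ⟨H.exists_isConj_isNormalForm, fun ⟨_, hgB, hB⟩ =>
    IsStronglyReal.of_isConj hgB (H.isStronglyReal_of_isNormalForm hB)⟩

end IsUnramifiedInvolution
end GUTwo

/-! ### Family (d): real but not strongly real -/

namespace GUTwo
namespace IsUnramifiedInvolution

variable {R : Type*} [CommRing R] [IsLocalRing R] {c : R →+* R} {ϖ : R}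

lemma mem_of_mul_eq_zero {v z : R} (hv : v ≠ 0) (h : v * z = 0) : z ∈ maximalIdeal R := by
  by_contra hz
  exact hv ((notMem_maximalIdeal.1 hz).mul_right_cancel (by rw [h, zero_mul]))

/-- A trace zero matrix with non-unit determinant whose multiple by `v ≠ 0` is, up to a fixed
scalar matrix, inverted by `W`, vanishes modulo the maximal ideal. -/
lemma mem_maximalIdeal_of_mul_eq (H : IsUnramifiedInvolution c ϖ) {v x a b p q r s : R}
    (hv : v ≠ 0) (hcv : c v = v) (hx : c x = x) (ha : c a = a) (hb : c b = -b)
    (hap : a = x + v * p) (hbq : b = v * q) (hbr : -b = v * r) (htr : p + s = 0)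
    (hdet : p * s - q * r ∈ maximalIdeal R) :
    p ∈ maximalIdeal R ∧ q ∈ maximalIdeal R ∧ r ∈ maximalIdeal R ∧ s ∈ maximalIdeal R := by
  have h1 : p - c p ∈ maximalIdeal R := by
    refine mem_of_mul_eq_zero hv ?_
    have := congrArg c hap
    rw [map_add, map_mul, ha, hx, hcv] at this
    linear_combination this - hap
  have h2 : q + c q ∈ maximalIdeal R := by
    refine mem_of_mul_eq_zero hv ?_
    have := congrArg c hbq
    rw [map_mul, hb, hcv] at this
    linear_combination -this - hbq
  have h3 : q + r ∈ maximalIdeal R :=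
    mem_of_mul_eq_zero hv (by linear_combination -hbq - hbr)
  have h4 : (q - p) * (q + p) ∈ maximalIdeal R := by
    -- Modulo the maximal ideal r = -q and s = -p, so the determinant becomes q² - p². As c fixes p
    -- and negates q there, it exchanges the factors q ± p up to sign.
    convert Ideal.add_mem _ hdet (Ideal.mul_mem_left _ q h3) using 1
    linear_combination -p * htr
  have h5 : q - p ∈ maximalIdeal R ∧ q + p ∈ maximalIdeal R := by
    rcases (IsLocalRing.maximalIdeal.isMaximal R).isPrime.mem_or_mem h4 with h | h
    · refine ⟨h, ?_⟩
      have := H.map_mem h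
      rw [map_sub] at this
      convert Ideal.add_mem _ (Ideal.sub_mem _ h2 this) h1 using 1
      ring
    · refine ⟨?_, h⟩
      have := H.map_mem h
      rw [map_add] at this
      convert Ideal.sub_mem _ (Ideal.sub_mem _ h2 this) h1 using 1
      ring
  have hp : p ∈ maximalIdeal R := H.mem_of_two_mul_mem (by
    convert Ideal.sub_mem _ h5.2 h5.1 using 1
    ring)
  have hq : q ∈ maximalIdeal R := H.mem_of_two_mul_mem (by
    convert Ideal.add_mem _ h5.1 h5.2 using 1
    ring)
  refine ⟨hp, hq, ?_, ?_⟩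
  · convert Ideal.sub_mem _ h3 hq using 1
    ring
  · convert Ideal.neg_mem_iff _ |>.2 hp using 1
    linear_combination htr

/-- Conjugation by diag(p, -p) negates the off-diagonal entries; it is unitary when p c(p) = -1. The
hypothesis `hxy` gives v c(y) = -v y, so inversion negates them too. -/
lemma isReal_of_val_eq (H : IsUnramifiedInvolution c ϖ) {g : unitaryGroup c} {x v w y : R}
    (hcv : c v = v) (hcw : c w = w) (hx : c x = x) (hxu : IsUnit x)
    (hxy : v * (x * c y + c x * y) = 0) (hg : g.1.1 = !![x, v * w * y; v * y, x]) :
    IsReal g := by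
  have hvy : v * c y = -(v * y) := by
    refine hxu.mul_left_cancel ?_
    rw [hx] at hxy
    linear_combination hxy
  obtain ⟨p, hp⟩ := H.exists_norm_eq_neg_one
  obtain ⟨h, hh⟩ := exists_unitaryGroup_val_eq (c := c) (p := p) (q := 0) (r := 0) (s := -p)
    (by simp; linear_combination -hp) (by simp) (by simp) (by simp; linear_combination -hp)
  refine ⟨h, ?_⟩
  rw [mul_inv_eq_iff_eq_mul]
  apply unitaryGroup_ext
  change h.1.1 * g.1.1 = (g⁻¹).1.1 * h.1.1
  rw [unitaryGroup_val_inv, hg, starOp_of, hh]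
  ext i j
  fin_cases i <;> fin_cases j <;> simp [hx, hcv, hcw]
  · ring
  · linear_combination p * w * hvy
  · linear_combination -p * hvy
  · ring

lemma not_isStronglyReal_of_val_eq (H : IsUnramifiedInvolution c ϖ) {g : unitaryGroup c}
    {x v w y : R} (hv : v ≠ 0) (hcv : c v = v) (hw : w ∈ maximalIdeal R)
    (hx : c x = x) (hxu : IsUnit x) (hyu : IsUnit y)
    (hxy : x ^ 2 - v ^ 2 * w * y ^ 2 = 1)
    (hg : g.1.1 = !![x, v * w * y; v * y, x]) :
    ¬ IsStronglyReal g := by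
  intro hs
  rcases H.exists_conj_weyl_of_isStronglyReal hs with h | ⟨k, hk⟩
  · have h1 : g.1.1 * g.1.1 = 1 := by
      rw [pow_two] at h
      exact congrArg (fun x : unitaryGroup c => x.1.1) h
    have h2 := congrFun (congrFun h1 1) 0
    rw [hg, Matrix.mul_fin_two] at h2
    simp only [Matrix.of_apply, Matrix.cons_val', Matrix.cons_val_zero,
      Matrix.cons_val_one, Matrix.cons_val_fin_one, Matrix.one_apply_ne (one_ne_zero)] at h2
    refine hv (((H.two.mul hxu).mul hyu).mul_left_cancel ?_)
    linear_combination h2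
  set K := k.1.1 with hK
  set K' := (k⁻¹).1.1 with hK'
  have hKK' : K * K' = 1 := congrArg (fun x : unitaryGroup c => x.1.1) (mul_inv_cancel k)
  have hK'K : K' * K = 1 := congrArg (fun x : unitaryGroup c => x.1.1) (inv_mul_cancel k)
  have hval : (k⁻¹ * g * k).1.1 = K' * g.1.1 * K := rfl
  have hdetg : g.1.1.det = 1 := by
    rw [hg, Matrix.det_fin_two_of]
    linear_combination hxy
  have hdet : (k⁻¹ * g * k).1.1.det = 1 := by
    rw [hval, Matrix.det_mul_right_comm, hK'K, one_mul, hdetg]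
  set M : Matrix (Fin 2) (Fin 2) R := !![0, w * y; y, 0] with hM
  have hgM : g.1.1 = x • 1 + v • M := by
    rw [hg, hM, Matrix.one_fin_two]
    simp [mul_assoc]
  have hval' : (k⁻¹ * g * k).1.1 = x • 1 + v • (K' * M * K) := by
    rw [hval, hgM, mul_add, add_mul]
    simp [hK'K]
  obtain ⟨p, q, r, s, hN⟩ : ∃ p q r s, K' * M * K = !![p, q; r, s] :=
    ⟨_, _, _, _, Matrix.eta_fin_two _⟩
  have htrN : p + s = 0 := by
    have : (K' * M * K).trace = 0 := by
      rw [Matrix.trace_mul_comm, ← mul_assoc, hKK', one_mul, hM, Matrix.trace_fin_two_of]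
      simp
    rwa [hN, Matrix.trace_fin_two_of] at this
  have hdetN : p * s - q * r ∈ maximalIdeal R := by
    have : (K' * M * K).det = -(w * y * y) := by
      rw [Matrix.det_mul_right_comm, hK'K, one_mul, hM, Matrix.det_fin_two_of]
      simp
    rw [hN, Matrix.det_fin_two_of] at this
    rw [this, Ideal.neg_mem_iff]
    exact Ideal.mul_mem_right _ _ (Ideal.mul_mem_right _ _ hw)
  obtain ⟨b, hb, -, hgb⟩ | ⟨a, b, d, ha, hd, hb, hab, hgb⟩ := H.eq_of_weyl_conj_eq_inv hk
  -- The antidiagonal form has determinant -b² = -1, whereas det g = 1.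
  · rw [hgb, Matrix.det_fin_two_of] at hdet
    have : (2 : R) = 0 := by linear_combination -hdet - hb
    exact not_isUnit_zero (this ▸ H.two)
  · rw [hgb, hN, Matrix.one_fin_two, ← Matrix.ext_iff] at hval'
    simp [Fin.forall_fin_two] at hval'
    obtain ⟨⟨e1, e2⟩, e3, e4⟩ := hval'
    obtain ⟨hp, hq, hr, hs'⟩ :=
      H.mem_maximalIdeal_of_mul_eq hv hcv hx ha hb e1 e2 e3 htrN hdetN
    -- Conjugating back, all entries of M would lie in the maximal ideal, but one of them is the
    -- unit y.
    have hMN : M = K * !![p, q; r, s] * K' := by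
      rw [← hN, mul_assoc, mul_assoc, mul_assoc, hKK', mul_one, ← mul_assoc, hKK', one_mul]
    have hy := congrFun (congrFun hMN 1) 0
    refine (mem_maximalIdeal _).1 ?_ hyu
    rw [show y = M 1 0 by rw [hM]; rfl, hy]
    simp only [Matrix.mul_apply, Fin.sum_univ_two, Matrix.of_apply, Matrix.cons_val',
      Matrix.cons_val_zero, Matrix.cons_val_one, Matrix.cons_val_fin_one]
    refine Ideal.add_mem _ (Ideal.mul_mem_right _ _ (Ideal.add_mem _ ?_ ?_))
      (Ideal.mul_mem_right _ _ (Ideal.add_mem _ ?_ ?_)) <;>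
    exact Ideal.mul_mem_left _ _ ‹_›

end IsUnramifiedInvolution
end GUTwo

/-! ### Unramified quadratic extensions: traces and an antifixed unit -/

namespace GUTwo

section Quadratic

lemma isUnit_two_of_odd_ringChar {A : Type*} [CommRing A] [IsLocalRing A]
    (hodd : Odd (ringChar (ResidueField A))) : IsUnit (2 : A) := by
  rw [← residue_ne_zero_iff_isUnit, map_ofNat]
  refine Ring.two_ne_zero fun h => ?_
  rw [h] at hodd
  exact absurd hodd (by decide)

lemma ringChar_residueField_ne_two {A : Type*} [CommRing A] [IsLocalRing A]
    (h : IsUnit (2 : A)) : ringChar (ResidueField A) ≠ 2 := by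
  intro hc
  have h0 := ringChar.Nat.cast_ringChar (R := ResidueField A)
  rw [hc] at h0
  refine (residue_ne_zero_iff_isUnit (2 : A)).2 h ?_
  rw [map_ofNat]
  exact_mod_cast h0

open Polynomial in
lemma exists_quadratic_eq {A B : Type*} [CommRing A] [CommRing B] [Nontrivial A] [Algebra A B]
    [Module.Finite A B] [Module.Free A B] (hrank : Module.finrank A B = 2) (y : B) :
    ∃ t n : A, y ^ 2 + algebraMap A B t * y + algebraMap A B n = 0 := by
  have hmon := LinearMap.charpoly_monic (Algebra.lmul A B y)
  have hdeg := LinearMap.charpoly_natDegree (Algebra.lmul A B y)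
  have hev := LinearMap.aeval_self_charpoly (Algebra.lmul A B y)
  generalize (Algebra.lmul A B y).charpoly = f at *
  rw [hrank] at hdeg
  have hf : f = X ^ 2 + C (f.coeff 1) * X + C (f.coeff 0) := by
    have h2 : f.coeff 2 = 1 := by rw [← hdeg]; exact hmon
    conv_lhs => rw [f.as_sum_range_C_mul_X_pow, hdeg]
    simp [Finset.sum_range_succ, h2]
    ring
  refine ⟨f.coeff 1, f.coeff 0, ?_⟩
  rw [aeval_algHom_apply] at hev
  have := LinearMap.congr_fun hev 1
  rw [hf] at this
  simpa using this

/-- Otherwise σ agrees with the identity modulo the maximal ideal, hence everywhere, by formal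
unramifiedness and Krull's intersection theorem. -/
lemma exists_isUnit_sub {𝔬 𝔒 : Type*} [CommRing 𝔬] [CommRing 𝔒] [IsDomain 𝔒]
    [IsNoetherianRing 𝔒] [IsLocalRing 𝔒] [Algebra 𝔬 𝔒] [Algebra.FormallyUnramified 𝔬 𝔒]
    {σ : 𝔒 ≃ₐ[𝔬] 𝔒} (hσ : σ ≠ 1) : ∃ x, IsUnit (σ x - x) := by
  by_contra! h
  apply hσ
  have hbot : ⨅ i, maximalIdeal 𝔒 ^ i = ⊥ :=
    Ideal.iInf_pow_eq_bot_of_isLocalRing _ (IsLocalRing.maximalIdeal.isMaximal 𝔒).ne_top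
  have := Algebra.FormallyUnramified.ext_of_iInf (R := 𝔬) (maximalIdeal 𝔒) hbot
    (g₁ := (σ : 𝔒 →ₐ[𝔬] 𝔒)) (g₂ := AlgHom.id 𝔬 𝔒)
    (fun x => (Ideal.Quotient.mk_eq_mk_iff_sub_mem _ _).2 ((mem_maximalIdeal _).2 (h x)))
  ext x
  exact DFunLike.congr_fun this x

variable {𝔬 𝔒 : Type*} [CommRing 𝔬] [IsDomain 𝔬] [IsDiscreteValuationRing 𝔬]
  [CommRing 𝔒] [IsDomain 𝔒] [Algebra 𝔬 𝔒]

lemma add_map_mem_range [Module.Finite 𝔬 𝔒] [FaithfulSMul 𝔬 𝔒]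
    (hrank : Module.finrank 𝔬 𝔒 = 2) (σ : 𝔒 ≃ₐ[𝔬] 𝔒) {y : 𝔒} (hy : σ y ≠ y) :
    ∃ t : 𝔬, y + σ y = algebraMap 𝔬 𝔒 t := by
  obtain ⟨t, n, h⟩ := exists_quadratic_eq hrank y
  have h' := congrArg σ h
  simp only [map_add, map_mul, map_pow, AlgEquiv.commutes, map_zero] at h'
  -- Both y and σ y are roots of the same monic quadratic over 𝔬; subtract and cancel y - σ y.
  refine ⟨-t, mul_left_cancel₀ (sub_ne_zero.2 hy) ?_⟩
  rw [map_neg]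
  linear_combination h' - h

lemma exists_antifixed [IsDiscreteValuationRing 𝔒] [Module.Finite 𝔬 𝔒] [FaithfulSMul 𝔬 𝔒]
    [Algebra.FormallyUnramified 𝔬 𝔒] (hrank : Module.finrank 𝔬 𝔒 = 2) {σ : 𝔒 ≃ₐ[𝔬] 𝔒} (hσ : σ ≠ 1) :
    ∃ (e : 𝔒) (D : 𝔬), IsUnit e ∧ σ e = -e ∧ e ^ 2 = algebraMap 𝔬 𝔒 D := by
  obtain ⟨x, hx⟩ := exists_isUnit_sub hσ
  have hne : σ x ≠ x := fun h => by simp [h] at hx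
  obtain ⟨t, n, h⟩ := exists_quadratic_eq hrank x
  obtain ⟨t', ht'⟩ := add_map_mem_range hrank σ hne
  have hs : σ (σ x) = x := by
    have := congrArg σ ht'
    rw [map_add, AlgEquiv.commutes] at this
    linear_combination this - ht'
  have ht : algebraMap 𝔬 𝔒 t' = -algebraMap 𝔬 𝔒 t := by
    have h' := congrArg σ h
    simp only [map_add, map_mul, map_pow, AlgEquiv.commutes, map_zero] at h'
    refine mul_left_cancel₀ (sub_ne_zero.2 hne) ?_
    linear_combination h' - h - (σ x - x) * ht'
  -- The square of the difference of the two roots is the discriminant.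
  refine ⟨σ x - x, t ^ 2 - 4 * n, hx, by rw [map_sub, hs]; ring, ?_⟩
  simp only [map_sub, map_mul, map_pow, map_ofNat]
  rw [show σ x = -algebraMap 𝔬 𝔒 t - x by linear_combination ht' + ht]
  linear_combination 4 * h

lemma exists_algebraMap_eq_add [Module.Finite 𝔬 𝔒] [FaithfulSMul 𝔬 𝔒]
    (hrank : Module.finrank 𝔬 𝔒 = 2) (σ : 𝔒 ≃ₐ[𝔬] 𝔒) (h2 : IsUnit (2 : 𝔬))
    {e : 𝔒} (heu : IsUnit e) (he : σ e = -e) (y : 𝔒) :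
    ∃ t : 𝔬, y + σ y = algebraMap 𝔬 𝔒 t := by
  by_cases hy : σ y = y
  · have h2' : IsUnit (2 : 𝔒) := map_ofNat (algebraMap 𝔬 𝔒) 2 ▸ h2.map (algebraMap 𝔬 𝔒)
    obtain ⟨t, ht⟩ := add_map_mem_range hrank σ (y := y + e) (fun h => by
      rw [map_add, hy, he] at h
      exact (h2'.mul heu).ne_zero (by linear_combination -h))
    refine ⟨t, ?_⟩
    rw [← ht, map_add, he]
    ring
  · exact add_map_mem_range hrank σ hy

end Quadratic

/-- An involution `σ` of `B` with fixed ring `A`, together with an invertible element `e` with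
`σ e = -e`. -/
structure IsQuadraticInvolution {A B : Type*} [CommRing A] [CommRing B] [Algebra A B]
    (σ : B ≃ₐ[A] B) (e : B) (D : A) : Prop where
  two : IsUnit (2 : A)
  unit : IsUnit e
  map_e : σ e = -e
  sq_e : e ^ 2 = algebraMap A B D
  trace : ∀ y, ∃ t : A, y + σ y = algebraMap A B t

/-! ### Squares and norms in the quadratic extension -/

namespace IsQuadraticInvolution

section

variable {A B : Type*} [CommRing A] [CommRing B] [Algebra A B] {σ : B ≃ₐ[A] B} {e : B} {D : A}

lemma two' (Q : IsQuadraticInvolution σ e D) : IsUnit (2 : B) :=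
  map_ofNat (algebraMap A B) 2 ▸ Q.two.map (algebraMap A B)

lemma exists_mul_eq_one (Q : IsQuadraticInvolution σ e D) : ∃ f, e * f = 1 ∧ σ f = -f := by
  obtain ⟨f, hf⟩ := Q.unit.exists_right_inv
  refine ⟨f, hf, ?_⟩
  apply Q.unit.mul_left_cancel
  have := congrArg σ hf
  rw [map_mul, Q.map_e, map_one] at this
  linear_combination -this + hf

lemma exists_eq_add (Q : IsQuadraticInvolution σ e D) (y : B) :
    ∃ a b : A, y = algebraMap A B a + algebraMap A B b * e := by
  obtain ⟨t, ht⟩ := Q.two.exists_right_inv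
  obtain ⟨f, hf, hσf⟩ := Q.exists_mul_eq_one
  have ht' : 2 * algebraMap A B t = 1 := by
    rw [← map_ofNat (algebraMap A B) 2, ← map_mul, ht, map_one]
  obtain ⟨a, ha⟩ := Q.trace y
  obtain ⟨b, hb⟩ := Q.trace (y * f)
  rw [map_mul, hσf] at hb
  -- The coordinates in the basis 1, e are half the traces of y and of y e⁻¹.
  refine ⟨t * a, t * b, ?_⟩
  rw [map_mul, map_mul, ← ha, ← hb]
  linear_combination -y * ht' - algebraMap A B t * (y - σ y) * hf

lemma map_map (Q : IsQuadraticInvolution σ e D) (y : B) : σ (σ y) = y := by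
  obtain ⟨a, b, rfl⟩ := Q.exists_eq_add y
  simp [Q.map_e]

lemma isUnit_D [IsLocalHom (algebraMap A B)]
    (Q : IsQuadraticInvolution σ e D) : IsUnit D := by
  rw [← isUnit_map_iff (algebraMap A B), ← Q.sq_e]
  exact Q.unit.pow 2

lemma map_mem_maximalIdeal {A B : Type*} [CommRing A] [CommRing B] [IsLocalRing B]
    [Algebra A B] {σ : B ≃ₐ[A] B} {y : B} (hy : y ∈ maximalIdeal B) :
    σ y ∈ maximalIdeal B := by
  simpa [mem_maximalIdeal] using hy

end

variable {𝔬 𝔒 : Type*} [CommRing 𝔬] [IsLocalRing 𝔬] [CommRing 𝔒] [IsLocalRing 𝔒] [Algebra 𝔬 𝔒]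
  [IsLocalHom (algebraMap 𝔬 𝔒)] {σ : 𝔒 ≃ₐ[𝔬] 𝔒} {e : 𝔒} {D : 𝔬}

lemma algebraMap_mem_iff (a : 𝔬) :
    algebraMap 𝔬 𝔒 a ∈ maximalIdeal 𝔒 ↔ a ∈ maximalIdeal 𝔬 := by
  simp [mem_maximalIdeal]

lemma mem_of_add_mem (Q : IsQuadraticInvolution σ e D) {a b : 𝔬}
    (h : algebraMap 𝔬 𝔒 a + algebraMap 𝔬 𝔒 b * e ∈ maximalIdeal 𝔒) :
    a ∈ maximalIdeal 𝔬 ∧ b ∈ maximalIdeal 𝔬 := by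
  have h' := map_mem_maximalIdeal (σ := σ) h
  simp only [map_add, map_mul, AlgEquiv.commutes, Q.map_e] at h'
  have ha : algebraMap 𝔬 𝔒 a ∈ maximalIdeal 𝔒 := by
    refine ((maximalIdeal 𝔒).unit_mul_mem_iff_mem Q.two').1 ?_
    convert Ideal.add_mem _ h h' using 1
    ring
  have hb : algebraMap 𝔬 𝔒 b ∈ maximalIdeal 𝔒 := by
    refine ((maximalIdeal 𝔒).unit_mul_mem_iff_mem Q.unit).1 ?_
    convert Ideal.sub_mem _ h ha using 1
    ring
  exact ⟨(algebraMap_mem_iff a).1 ha, (algebraMap_mem_iff b).1 hb⟩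

lemma maximalIdeal_eq_span (Q : IsQuadraticInvolution σ e D) {π : 𝔬}
    (hπ : maximalIdeal 𝔬 = Ideal.span {π}) :
    maximalIdeal 𝔒 = Ideal.span {algebraMap 𝔬 𝔒 π} := by
  apply le_antisymm
  · intro y hy
    obtain ⟨a, b, rfl⟩ := Q.exists_eq_add y
    obtain ⟨ha, hb⟩ := Q.mem_of_add_mem hy
    rw [hπ, Ideal.mem_span_singleton] at ha hb
    rw [Ideal.mem_span_singleton]
    exact dvd_add (map_dvd _ ha) (Dvd.dvd.mul_right (map_dvd _ hb) _)
  · rw [Ideal.span_singleton_le_iff_mem, algebraMap_mem_iff, hπ]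
    exact Ideal.mem_span_singleton_self _

/-- If D ≡ d², then e + d or e - d is a non-unit of 𝔒, although its coefficient at e is 1. -/
lemma not_isSquare_residue (Q : IsQuadraticInvolution σ e D) : ¬ IsSquare (residue 𝔬 D) := by
  rintro ⟨r, hr⟩
  obtain ⟨d, rfl⟩ := residue_surjective r
  have h1 : D - d * d ∈ maximalIdeal 𝔬 := by
    rw [← residue_eq_zero_iff, map_sub, map_mul, hr, sub_self]
  have h2 : (algebraMap 𝔬 𝔒 d + algebraMap 𝔬 𝔒 1 * e) * (-algebraMap 𝔬 𝔒 d + e) ∈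
      maximalIdeal 𝔒 := by
    rw [← algebraMap_mem_iff (𝔒 := 𝔒)] at h1
    convert h1 using 1
    simp only [map_sub, map_mul, map_one]
    linear_combination Q.sq_e
  rcases (IsLocalRing.maximalIdeal.isMaximal 𝔒).isPrime.mem_or_mem h2 with h | h
  · exact (Q.mem_of_add_mem h).2 isUnit_one
  · exact (Q.mem_of_add_mem (a := -d) (b := 1) (by simpa using h)).2 isUnit_one

open Polynomial in
lemma exists_sq_eq [IsAdicComplete (maximalIdeal 𝔬) 𝔬] (h2 : IsUnit (2 : 𝔬)) {u : 𝔬}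
    (hu : IsUnit u) (h : IsSquare (residue 𝔬 u)) : ∃ s, s ^ 2 = u := by
  obtain ⟨r, hr⟩ := h
  obtain ⟨d, rfl⟩ := residue_surjective r
  have hd : IsUnit d := by
    rw [← residue_ne_zero_iff_isUnit]
    intro h0
    rw [h0, mul_zero, residue_eq_zero_iff] at hr
    exact hr hu
  obtain ⟨s, hs, -⟩ := HenselianRing.is_henselian (I := maximalIdeal 𝔬) (X ^ 2 - C u)
    (monic_X_pow_sub_C u two_ne_zero) d
    (by rw [← residue_eq_zero_iff]; simp [hr, pow_two])
    (by
      refine IsUnit.map _ ?_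
      simpa [one_add_one_eq_two] using And.intro h2 hd)
  exact ⟨s, by simpa [sub_eq_zero] using hs⟩

/-- In a finite field a product of two nonsquares is a square, so u or u D⁻¹ is a residual square;
Hensel lifts its root. In terms of 𝔒, u is the square of s or of e s. -/
lemma exists_sq_or [IsAdicComplete (maximalIdeal 𝔬) 𝔬] [Finite (ResidueField 𝔬)]
    (Q : IsQuadraticInvolution σ e D) {u : 𝔬} (hu : IsUnit u) :
    ∃ s : 𝔬, s ^ 2 = u ∨ D * s ^ 2 = u := by
  by_cases h : IsSquare (residue 𝔬 u)
  · obtain ⟨s, hs⟩ := exists_sq_eq Q.two hu h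
    exact ⟨s, .inl hs⟩
  · obtain ⟨D', hD'⟩ := Q.isUnit_D.exists_right_inv
    have hD'u : IsUnit D' := IsUnit.of_mul_eq_one D (by rw [mul_comm, hD'])
    have hD's : ¬ IsSquare (residue 𝔬 D') := by
      rintro ⟨r, hr⟩
      apply Q.not_isSquare_residue
      have h1 : residue 𝔬 D * residue 𝔬 D' = 1 := by rw [← map_mul, hD', map_one]
      refine ⟨residue 𝔬 D * r, ?_⟩
      linear_combination -residue 𝔬 D * h1 + residue 𝔬 D ^ 2 * hr
    have hsq : IsSquare (residue 𝔬 (u * D')) := by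
      classical
      have := Fintype.ofFinite (ResidueField 𝔬)
      rw [map_mul, ← quadraticChar_one_iff_isSquare, map_mul,
        (quadraticChar_neg_one_iff_not_isSquare).2 h,
        (quadraticChar_neg_one_iff_not_isSquare).2 hD's]
      · norm_num
      · exact mul_ne_zero ((residue_ne_zero_iff_isUnit _).2 hu)
          ((residue_ne_zero_iff_isUnit _).2 hD'u)
    obtain ⟨s, hs⟩ := exists_sq_eq Q.two (hu.mul hD'u) hsq
    exact ⟨s, .inr (by rw [hs]; linear_combination u * hD')⟩

open Polynomial in
lemma exists_norm_eq {𝔬 𝔒 : Type*} [CommRing 𝔬] [IsLocalRing 𝔬] [CommRing 𝔒] [Algebra 𝔬 𝔒]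
    [IsLocalHom (algebraMap 𝔬 𝔒)] {σ : 𝔒 ≃ₐ[𝔬] 𝔒} {e : 𝔒} {D : 𝔬}
    [IsAdicComplete (maximalIdeal 𝔬) 𝔬] [Finite (ResidueField 𝔬)]
    (Q : IsQuadraticInvolution σ e D) {u : 𝔬} (hu : IsUnit u) :
    ∃ z : 𝔒, z * σ z = algebraMap 𝔬 𝔒 u := by
  -- The equation a² - D b² = u, a norm equation for a + b e, is always solvable in the residue
  -- field.
  obtain ⟨a, b, hab⟩ : ∃ a b : 𝔬, residue 𝔬 a ^ 2 = residue 𝔬 (u + D * b ^ 2) := by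
    have := Fintype.ofFinite (ResidueField 𝔬)
    have hD : -residue 𝔬 D ≠ 0 := neg_ne_zero.2 ((residue_ne_zero_iff_isUnit _).2 Q.isUnit_D)
    obtain ⟨a, b, h⟩ := FiniteField.exists_root_sum_quadratic
      (f := (X ^ 2 : (ResidueField 𝔬)[X]))
      (g := C (-residue 𝔬 D) * X ^ 2 + C 0 * X + C (-residue 𝔬 u)) (degree_X_pow 2)
      (degree_quadratic hD)
      (FiniteField.odd_card_of_char_ne_two (ringChar_residueField_ne_two Q.two))
    obtain ⟨a, rfl⟩ := residue_surjective a
    obtain ⟨b, rfl⟩ := residue_surjective b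
    refine ⟨a, b, ?_⟩
    simp at h ⊢
    linear_combination h
  -- Hensel can lift a only if a is nonzero in the residue field. If it is zero, then -D u ≡ (D b)²
  -- has a square root s, and s e⁻¹ has norm -s²/D = u.
  by_cases ha : residue 𝔬 a = 0
  · obtain ⟨s, hs⟩ : ∃ s, s ^ 2 = -(D * u) := by
      refine exists_sq_eq Q.two (Q.isUnit_D.mul hu).neg ⟨residue 𝔬 (D * b), ?_⟩
      rw [ha] at hab
      simp at hab ⊢
      linear_combination residue 𝔬 D * hab
    obtain ⟨f, hf, hσf⟩ := Q.exists_mul_eq_one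
    refine ⟨algebraMap 𝔬 𝔒 s * f, ?_⟩
    have := congrArg (algebraMap 𝔬 𝔒) hs
    rw [map_pow, map_neg, map_mul, ← Q.sq_e] at this
    rw [map_mul, AlgEquiv.commutes, hσf]
    linear_combination -f ^ 2 * this + (e * f + 1) * algebraMap 𝔬 𝔒 u * hf
  · obtain ⟨s, hs⟩ : ∃ s, s ^ 2 = u + D * b ^ 2 := by
      refine exists_sq_eq Q.two ?_ ⟨residue 𝔬 a, by rw [← hab, pow_two]⟩
      rw [← residue_ne_zero_iff_isUnit, ← hab]
      exact pow_ne_zero 2 ha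
    refine ⟨algebraMap 𝔬 𝔒 s + algebraMap 𝔬 𝔒 b * e, ?_⟩
    have := congrArg (algebraMap 𝔬 𝔒) hs
    simp only [map_pow, map_add, map_mul, ← Q.sq_e] at this
    simp only [map_add, map_mul, AlgEquiv.commutes, Q.map_e]
    linear_combination this

end IsQuadraticInvolution
end GUTwo

/-! ### Passage to the truncations -/

namespace GUTwo

lemma conj_mk {𝔬 𝔒 : Type*} [CommRing 𝔬] [CommRing 𝔒] [IsLocalRing 𝔒] [Algebra 𝔬 𝔒]
    (σ : 𝔒 ≃ₐ[𝔬] 𝔒) (ℓ : ℕ) (z : 𝔒) :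
    conj σ ℓ (Ideal.Quotient.mk _ z) = Ideal.Quotient.mk _ (σ z) := rfl

lemma isUnit_mk_iff {A : Type*} [CommRing A] [IsLocalRing A] {ℓ : ℕ} (hℓ : 1 ≤ ℓ) {z : A} :
    IsUnit (Ideal.Quotient.mk (maximalIdeal A ^ ℓ) z) ↔ IsUnit z := by
  refine ⟨fun h => ?_, fun h => h.map _⟩
  obtain ⟨w, hw⟩ := h.exists_right_inv
  obtain ⟨w, rfl⟩ := Ideal.Quotient.mk_surjective w
  rw [← map_mul, ← map_one (Ideal.Quotient.mk _), Ideal.Quotient.mk_eq_mk_iff_sub_mem] at hw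
  rw [← notMem_maximalIdeal]
  intro hz
  apply (Ideal.ne_top_iff_one _).1 (IsLocalRing.maximalIdeal.isMaximal A).ne_top
  convert Ideal.sub_mem _ (Ideal.mul_mem_right w _ hz)
    (Ideal.pow_le_self (by omega : ℓ ≠ 0) hw) using 1
  ring

instance isLocalRing_trunc_succ {A : Type*} [CommRing A] [IsLocalRing A] (n : ℕ) :
    IsLocalRing (Trunc A (n + 1)) := by
  have : Nontrivial (Trunc A (n + 1)) := Ideal.Quotient.nontrivial_iff.2 <|
    ne_top_of_le_ne_top (IsLocalRing.maximalIdeal.isMaximal A).ne_top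
      (Ideal.pow_le_self n.succ_ne_zero)
  exact IsLocalRing.of_surjective' (Ideal.Quotient.mk _) Ideal.Quotient.mk_surjective

namespace IsQuadraticInvolution

section

variable {𝔬 𝔒 : Type*} [CommRing 𝔬] [IsLocalRing 𝔬] [CommRing 𝔒] [IsLocalRing 𝔒] [Algebra 𝔬 𝔒]
  [IsLocalHom (algebraMap 𝔬 𝔒)] {σ : 𝔒 ≃ₐ[𝔬] 𝔒} {e : 𝔒} {D : 𝔬} {ℓ : ℕ}

lemma incl_mk (a : 𝔬) : incl 𝔬 𝔒 ℓ (Ideal.Quotient.mk _ a) =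
    Ideal.Quotient.mk _ (algebraMap 𝔬 𝔒 a) := rfl

lemma conj_incl (a : Trunc 𝔬 ℓ) : conj σ ℓ (incl 𝔬 𝔒 ℓ a) = incl 𝔬 𝔒 ℓ a := by
  obtain ⟨a, rfl⟩ := Ideal.Quotient.mk_surjective a
  rw [incl_mk, conj_mk, AlgEquiv.commutes]

lemma exists_mk_algebraMap_eq {A B : Type*} [CommRing A] [CommRing B] [IsLocalRing B]
    [Algebra A B] {σ : B ≃ₐ[A] B} {e : B} {D : A} {ℓ : ℕ} (Q : IsQuadraticInvolution σ e D)
    {z : Trunc B ℓ} (hz : conj σ ℓ z = z) : ∃ a : A, Ideal.Quotient.mk _ (algebraMap A B a) = z := by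
  obtain ⟨y, rfl⟩ := Ideal.Quotient.mk_surjective z
  obtain ⟨t, ht⟩ := Q.two.exists_right_inv
  obtain ⟨a, ha⟩ := Q.trace y
  -- A fixed class is half its trace, and the trace of any lift lies in the base ring.
  refine ⟨t * a, ?_⟩
  have ht' := congrArg (fun x => Ideal.Quotient.mk (maximalIdeal B ^ ℓ) (algebraMap A B x)) ht
  simp only [map_mul, map_one, map_ofNat] at ht'
  have ha' := congrArg (Ideal.Quotient.mk (maximalIdeal B ^ ℓ)) ha
  rw [conj_mk] at hz
  rw [map_add, hz] at ha'
  rw [map_mul, map_mul, ← ha']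
  linear_combination Ideal.Quotient.mk (maximalIdeal B ^ ℓ) y * ht'

lemma exists_incl_eq (Q : IsQuadraticInvolution σ e D) {z : Trunc 𝔒 ℓ}
    (hz : conj σ ℓ z = z) : ∃ a : Trunc 𝔬 ℓ, incl 𝔬 𝔒 ℓ a = z := by
  obtain ⟨a, ha⟩ := Q.exists_mk_algebraMap_eq hz
  exact ⟨Ideal.Quotient.mk _ a, ha⟩

lemma incl_injective (Q : IsQuadraticInvolution σ e D) {π : 𝔬}
    (hπ : maximalIdeal 𝔬 = Ideal.span {π}) (hinj : Function.Injective (algebraMap 𝔬 𝔒)) :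
    Function.Injective (incl 𝔬 𝔒 ℓ) := by
  rw [injective_iff_map_eq_zero]
  intro a ha
  obtain ⟨a, rfl⟩ := Ideal.Quotient.mk_surjective a
  rw [incl_mk, Ideal.Quotient.eq_zero_iff_mem, Q.maximalIdeal_eq_span hπ,
    Ideal.span_singleton_pow, Ideal.mem_span_singleton] at ha
  rw [Ideal.Quotient.eq_zero_iff_mem, hπ, Ideal.span_singleton_pow, Ideal.mem_span_singleton]
  obtain ⟨z, hz⟩ := ha
  obtain ⟨t, ht⟩ := Q.trace z
  -- Taking traces in a = π^ℓ z gives 2a = π^ℓ (z + σ z), a divisibility in 𝔬.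
  rw [← Q.two.dvd_mul_left]
  refine ⟨t, hinj ?_⟩
  have h' := congrArg σ hz
  simp only [map_mul, map_pow, AlgEquiv.commutes] at h'
  simp only [map_mul, map_pow, map_ofNat, ← ht]
  linear_combination hz + h'

end

variable {𝔬 𝔒 : Type*} [CommRing 𝔬] [IsLocalRing 𝔬] [CommRing 𝔒] [IsDomain 𝔒]
  [IsDiscreteValuationRing 𝔒] [Algebra 𝔬 𝔒]
  [IsLocalHom (algebraMap 𝔬 𝔒)] {σ : 𝔒 ≃ₐ[𝔬] 𝔒} {e : 𝔒} {D : 𝔬}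

lemma isUnramifiedInvolution [IsAdicComplete (maximalIdeal 𝔬) 𝔬] [Finite (ResidueField 𝔬)]
    (Q : IsQuadraticInvolution σ e D) {π : 𝔬} (hπ : maximalIdeal 𝔬 = Ideal.span {π}) (n : ℕ) :
    IsUnramifiedInvolution (conj σ (n + 1))
      (Ideal.Quotient.mk (maximalIdeal 𝔒 ^ (n + 1)) (algebraMap 𝔬 𝔒 π)) where
  invol z := by
    obtain ⟨y, rfl⟩ := Ideal.Quotient.mk_surjective z
    rw [conj_mk, conj_mk, Q.map_map]
  two := map_ofNat (Ideal.Quotient.mk (maximalIdeal 𝔒 ^ (n + 1))) 2 ▸ Q.two'.map _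
  norm u hu hcu := by
    obtain ⟨a, rfl⟩ := Q.exists_mk_algebraMap_eq hcu
    rw [isUnit_mk_iff n.succ_pos, isUnit_map_iff] at hu
    obtain ⟨z, hz⟩ := Q.exists_norm_eq hu
    exact ⟨Ideal.Quotient.mk _ z, by rw [conj_mk, ← map_mul, hz]⟩
  sqrt u hu hcu := by
    obtain ⟨a, rfl⟩ := Q.exists_mk_algebraMap_eq hcu
    rw [isUnit_mk_iff n.succ_pos, isUnit_map_iff] at hu
    obtain ⟨s, rfl | rfl⟩ := Q.exists_sq_or hu
    · exact ⟨Ideal.Quotient.mk _ (algebraMap 𝔬 𝔒 s), by simp only [map_pow],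
        .inl (by rw [conj_mk, AlgEquiv.commutes])⟩
    · refine ⟨Ideal.Quotient.mk _ (e * algebraMap 𝔬 𝔒 s), ?_, .inr ?_⟩
      · rw [← map_pow, mul_pow, Q.sq_e, map_mul (algebraMap 𝔬 𝔒), map_pow (algebraMap 𝔬 𝔒)]
      · rw [conj_mk, map_mul σ, AlgEquiv.commutes, Q.map_e, neg_mul, map_neg]
  fix := by rw [conj_mk, AlgEquiv.commutes]
  mem := by
    rw [mem_maximalIdeal, mem_nonunits_iff, isUnit_mk_iff n.succ_pos]
    exact (algebraMap_mem_iff π).2 (hπ ▸ Ideal.mem_span_singleton_self π)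
  chain z hz := by
    obtain ⟨y, rfl⟩ := Ideal.Quotient.mk_surjective z
    have hy : y ≠ 0 := by rintro rfl; exact hz (map_zero _)
    have hirr : Irreducible (algebraMap 𝔬 𝔒 π) :=
      (IsDiscreteValuationRing.irreducible_iff_uniformizer _).2 (Q.maximalIdeal_eq_span hπ)
    obtain ⟨k, u, hu⟩ := IsDiscreteValuationRing.associated_pow_irreducible hy hirr
    refine ⟨k, Ideal.Quotient.mk _ (↑u⁻¹ : 𝔒), u⁻¹.isUnit.map _, ?_⟩
    rw [← map_pow, ← hu, ← map_mul, Units.mul_inv_cancel_right]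

end IsQuadraticInvolution

lemma exists_isQuadraticInvolution {𝔬 𝔒 : Type*} [CommRing 𝔬] [IsDomain 𝔬]
    [IsDiscreteValuationRing 𝔬] [CommRing 𝔒] [IsDomain 𝔒] [IsDiscreteValuationRing 𝔒]
    [Algebra 𝔬 𝔒] [FaithfulSMul 𝔬 𝔒] [Module.Finite 𝔬 𝔒] [Algebra.FormallyUnramified 𝔬 𝔒]
    (hodd : Odd (ringChar (ResidueField 𝔬))) (hrank : Module.finrank 𝔬 𝔒 = 2)
    {σ : 𝔒 ≃ₐ[𝔬] 𝔒} (hσ : σ ≠ 1) : ∃ (e : 𝔒) (D : 𝔬), IsQuadraticInvolution σ e D := by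
  obtain ⟨e, D, heu, he, hD⟩ := exists_antifixed hrank hσ
  have h2 := isUnit_two_of_odd_ringChar hodd
  exact ⟨e, D, h2, heu, he, hD, exists_algebraMap_eq_add hrank σ h2 heu he⟩

/-- The normal forms are the matrices in the families (a), (b) and (c). -/
lemma IsQuadraticInvolution.isNormalForm_iff {𝔬 𝔒 : Type*} [CommRing 𝔬] [IsLocalRing 𝔬]
    [CommRing 𝔒] [IsLocalRing 𝔒] [Algebra 𝔬 𝔒] [IsLocalHom (algebraMap 𝔬 𝔒)] {σ : 𝔒 ≃ₐ[𝔬] 𝔒}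
    {e : 𝔒} {D : 𝔬} {ℓ : ℕ} (Q : IsQuadraticInvolution σ e D) {π : 𝔬}
    (hπ : maximalIdeal 𝔬 = Ideal.span {π}) (hinj : Function.Injective (algebraMap 𝔬 𝔒))
    (M : Matrix (Fin 2) (Fin 2) (Trunc 𝔒 ℓ)) :
    IsUnramifiedInvolution.IsNormalForm (conj σ ℓ) M ↔
      M ∈ familyA 𝔒 ℓ ∪ familyB 𝔬 𝔒 ℓ ∪ familyC σ ℓ := by
  have hi := Q.incl_injective (ℓ := ℓ) hπ hinj
  rw [IsUnramifiedInvolution.IsNormalForm, Set.mem_union, Set.mem_union, or_assoc]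
  refine or_congr Iff.rfl (or_congr ⟨?_, ?_⟩ Iff.rfl)
  · rintro ⟨x, y, hx, hy, hxy, hx2, rfl⟩
    obtain ⟨a, rfl⟩ := Q.exists_incl_eq hx
    obtain ⟨b, rfl⟩ := Q.exists_incl_eq hy
    have hab : a * b = 1 := hi (by rw [map_mul, hxy, map_one])
    refine ⟨⟨a, b, hab, by rw [mul_comm, hab]⟩, fun h => hx2 ?_, rfl⟩
    rw [← map_pow, ← map_one (incl 𝔬 𝔒 ℓ)]
    exact congrArg _ (congrArg Units.val h)
  · rintro ⟨x, hx, rfl⟩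
    refine ⟨_, _, conj_incl _, conj_incl _, by rw [← map_mul, Units.mul_inv, map_one], ?_, rfl⟩
    intro h
    rw [← map_pow, ← map_one (incl 𝔬 𝔒 ℓ)] at h
    exact hx (Units.ext (by rw [Units.val_pow_eq_pow_val, hi h, Units.val_one]))

end GUTwo
/-- Let `𝔬` be a complete discrete valuation ring with finite residue field of odd characteristic,
`π` a uniformizer, `𝔒` an unramified quadratic extension of `𝔬` with nontrivial automorphism `σ`,
and `ℓ ≥ 1`. A real element of `GU₂(𝔬_ℓ)` is strongly real if and only if it is conjugate to an
element of one of the families (a), (b), (c); the elements of family (d) are real but not strongly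
real. -/
theorem mainTheorem6
    {𝔬 : Type*} [CommRing 𝔬] [IsDomain 𝔬] [IsDiscreteValuationRing 𝔬]
    [IsAdicComplete (IsLocalRing.maximalIdeal 𝔬) 𝔬]
    [Finite (IsLocalRing.ResidueField 𝔬)]
    (hodd : Odd (ringChar (IsLocalRing.ResidueField 𝔬)))
    (π : 𝔬) (hπ : Irreducible π)
    {𝔒 : Type*} [CommRing 𝔒] [IsDomain 𝔒] [IsDiscreteValuationRing 𝔒]
    [Algebra 𝔬 𝔒] [FaithfulSMul 𝔬 𝔒] [Module.Finite 𝔬 𝔒] [Algebra.FormallyUnramified 𝔬 𝔒]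
    (hrank : Module.finrank 𝔬 𝔒 = 2)
    (σ : 𝔒 ≃ₐ[𝔬] 𝔒) (hσ : σ ≠ 1)
    (ℓ : ℕ) (hℓ : 1 ≤ ℓ) :
    (∀ A : GUTwo.GU σ ℓ, GUTwo.IsReal A →
      (GUTwo.IsStronglyReal A ↔
        ∃ B : GUTwo.GU σ ℓ, IsConj A B ∧
          ((B : Matrix.GeneralLinearGroup (Fin 2) (GUTwo.Trunc 𝔒 ℓ)) :
              Matrix (Fin 2) (Fin 2) (GUTwo.Trunc 𝔒 ℓ)) ∈
            GUTwo.familyA 𝔒 ℓ ∪ GUTwo.familyB 𝔬 𝔒 ℓ ∪ GUTwo.familyC σ ℓ)) ∧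
    (∀ A : GUTwo.GU σ ℓ,
      ((A : Matrix.GeneralLinearGroup (Fin 2) (GUTwo.Trunc 𝔒 ℓ)) :
          Matrix (Fin 2) (Fin 2) (GUTwo.Trunc 𝔒 ℓ)) ∈ GUTwo.familyD π σ ℓ →
        GUTwo.IsReal A ∧ ¬ GUTwo.IsStronglyReal A) := by
  obtain ⟨e, D, Q⟩ := GUTwo.exists_isQuadraticInvolution hodd hrank hσ
  have hπ' := (IsDiscreteValuationRing.irreducible_iff_uniformizer π).1 hπ
  have hinj := FaithfulSMul.algebraMap_injective 𝔬 𝔒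
  -- The successor form makes the instance `isLocalRing_trunc_succ` available.
  obtain ⟨n, rfl⟩ : ∃ n, ℓ = n + 1 := ⟨ℓ - 1, by omega⟩
  have H := Q.isUnramifiedInvolution hπ' n
  refine ⟨fun A _ => ?_, ?_⟩
  · rw [H.isStronglyReal_iff]
    simp only [Q.isNormalForm_iff hπ' hinj]
  · rintro A ⟨i, hi, b, a, u, h1, h2, h3, hA⟩
    set ϖ := Ideal.Quotient.mk (IsLocalRing.maximalIdeal 𝔒 ^ (n + 1)) (algebraMap 𝔬 𝔒 π) with hϖ
    have hv : ϖ ^ i ≠ 0 := by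
      rw [hϖ, ← map_pow, ← map_pow, Ne, Ideal.Quotient.eq_zero_iff_mem,
        Q.maximalIdeal_eq_span hπ', Ideal.span_singleton_pow, Ideal.mem_span_singleton, map_pow]
      have hirr : Irreducible (algebraMap 𝔬 𝔒 π) :=
        (IsDiscreteValuationRing.irreducible_iff_uniformizer _).2 (Q.maximalIdeal_eq_span hπ')
      rw [pow_dvd_pow_iff hirr.ne_zero hirr.not_isUnit]
      omega
    have hcv : GUTwo.conj σ (n + 1) (ϖ ^ i) = ϖ ^ i := by rw [map_pow, H.fix]
    have hx := GUTwo.IsQuadraticInvolution.conj_incl (σ := σ) (a : GUTwo.Trunc 𝔬 (n + 1))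
    have hb := GUTwo.IsQuadraticInvolution.conj_incl (σ := σ) b
    have hxu : IsUnit (GUTwo.incl 𝔬 𝔒 (n + 1) a) := a.isUnit.map _
    -- Grouping ϖ with β gives v = ϖⁱ ≠ 0 and w = ϖβ in the maximal ideal, so the matrix ϖⁱ
    -- multiplies has non-unit determinant.
    have hA' := hA.trans (show _ = !![GUTwo.incl 𝔬 𝔒 (n + 1) a,
      ϖ ^ i * (ϖ * GUTwo.incl 𝔬 𝔒 (n + 1) b) * u; ϖ ^ i * u, GUTwo.incl 𝔬 𝔒 (n + 1) a] by
        simp only [pow_succ, mul_assoc])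
    refine ⟨H.isReal_of_val_eq hcv (by rw [map_mul, H.fix, hb]) hx hxu h3 hA',
      H.not_isStronglyReal_of_val_eq hv hcv (Ideal.mul_mem_right _ _ H.mem) hx hxu u.isUnit ?_ hA'⟩
    rw [← h2]
    ring
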